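/- Write $\mathbb H$ for the quaternions $q=x_0+x_1i+x_2j+x_3k=x_0+\vec q$ and $\mathbb S=\{I\in\mathbb H: I^2=-1\}$; for $I\in\mathbb S$ let $\mathbb C_I=\mathbb R+\mathbb R I$. An open connected nonempty set $\Omega\subset\mathbb H$ is an axially symmetric slice domain if $\Omega\cap\mathbb R\neq\emptyset$, if $\Omega\cap\mathbb C_I$ is a domain of $\mathbb C_I$ for every $I\in\mathbb S$, and if $x+yI\in\Omega$ with $x,y\in\mathbb R$, $I\in\mathbb S$ implies $x+yJ\in\Omega$ for all $J\in\mathbb S$. A function $f:\Omega\to\mathbb H$ of class $C^n$ is (left) slice polyanalytic of order $n$ if it is a slice function, i.e. $f(x+yI)=\alpha(x,y)+I\beta(x,y)$ for all $x+yI\in\Omega$, with $\mathbb H$-valued $\alpha,\beta$ such that $\alpha(x,-y)=\alpha(x,y)$, $\beta(x,-y)=-\beta(x,y)$, and if for every $I\in\mathbb S$ its restriction $f_I$ to $\Omega\cap\mathbb C_I$ satisfies $$\frac1{2^n}\Big(\frac{\partial}{\partial x}+I\frac{\partial}{\partial y}\Big)^n f_I(x+yI)=0 .$$ For $g:\Omega\to\mathbb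 H$ of class $C^1$ on $\Omega\setminus\mathbb R$ put $$V(g)(q)=\partial_{x_0}g(q)+\frac{\vec q}{|\vec q|^2}\sum_{l=1}^3x_l\,\partial_{x_l}g(q),\qquad q\in\Omega\setminus\mathbb R,$$ and, if this function has a (necessarily unique) continuous extension to $\Omega$, denote the extension by $V(g)$ too. Put $V^0(f)=f$; one says that $V^{k}(f)$ is a function on $\Omega$, for $k\ge1$, if $V^{k-1}(f)$ is a function on $\Omega$ of class $C^1$ on $\Omega\setminus\mathbb R$ and $V^k(f):=V(V^{k-1}(f))$ extends continuously to $\Omega$. Let $\Delta$ be the Laplacian of $\mathbb R^4\cong\mathbb H$. **Theorem (Poly-Fueter mapping theorem I).** Let $\Omega$ be an axially symmetric slice domain in $\mathbb H$ and let $f:\Omega\to\mathbb H$ be slice polyanalytic of order $n\ge1$. Then $V^{n-1}(f)$ is a function on $\Omega$ in the above sense, it is of class $C^2$ on $\Omega$, and the function $$\tau_n(f)=\Delta\circ V^{n-1}(f):\Omega\to\mathbb H$$ is (left) Fueter regular on $\Omega$, that is, it is of class $C^1$ and $$\Big(\frac{\partial}{\partial x_0}+i\frac{\partial}{\partial x_1}+j\frac{\partial}{\partial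 x_2}+k\frac{\partial}{\partial x_3}\Big)\tau_n(f)(q)=0\qquad\text{for all }q\in\Omega .$$ -/

import Mathlib

open scoped Quaternion

noncomputable section

namespace PolyFueter

/-- The sphere `𝕊` of imaginary units. -/
def imagUnits : Set ℍ := {I | I ^ 2 = -1}

/-- The real axis inside `ℍ`. -/
def realAxis : Set ℍ := Set.range fun x : ℝ => (x : ℍ)

/-- The plane `ℂ_I = ℝ + ℝ I`. -/
def slicePlane (I : ℍ) : Set ℍ := {q | ∃ x y : ℝ, q = (x : ℍ) + y • I}

/-- Axially symmetric slice domains. The set `Ω ∩ ℂ_I` is automatically open in `ℂ_I`,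
since `Ω` is open, so it is a domain of `ℂ_I` as soon as it is (nonempty and) connected. -/
structure IsAxSymSliceDomain (Ω : Set ℍ) : Prop where
  isOpen : IsOpen Ω
  isConnected : IsConnected Ω
  meets_real : (Ω ∩ realAxis).Nonempty
  slice_connected : ∀ I ∈ imagUnits, IsConnected (Ω ∩ slicePlane I)
  axially_symmetric : ∀ (x y : ℝ), ∀ I ∈ imagUnits, ∀ J ∈ imagUnits,
    (x : ℍ) + y • I ∈ Ω → (x : ℍ) + y • J ∈ Ω

/-! A function `Ω → ℍ` on an open set `Ω` is represented by a total function `ℍ → ℍ` whose values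
outside `Ω` are arbitrary; all the notions below depend only on its values on `Ω`. -/

/-- Slice functions: `f (x + y I) = α (x, y) + I β (x, y)` on `Ω`, with `α` even and `β` odd
in `y`. -/
def IsSliceFunctionOn (Ω : Set ℍ) (f : ℍ → ℍ) : Prop :=
  ∃ α β : ℝ → ℝ → ℍ, ∀ (x y : ℝ), ∀ I ∈ imagUnits, (x : ℍ) + y • I ∈ Ω →
    α x (-y) = α x y ∧ β x (-y) = -β x y ∧ f ((x : ℍ) + y • I) = α x y + I * β x y

/-- The slice Cauchy-Riemann operator `(1 / 2) (∂/∂x + I ∂/∂y)`. At `q = x + I y` in `ℂ_I` the two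
line derivatives are the partial derivatives in `x` and in `y` of the restriction of `f`
to `ℂ_I`. -/
def dbar (I : ℍ) (f : ℍ → ℍ) (q : ℍ) : ℍ :=
  (1 / 2 : ℝ) • (lineDeriv ℝ f q 1 + I * lineDeriv ℝ f q I)

/-- (Left) slice polyanalytic functions of order `n` on `Ω`. -/
structure IsSlicePolyanalyticOn (n : ℕ) (Ω : Set ℍ) (f : ℍ → ℍ) : Prop where
  slice : IsSliceFunctionOn Ω f
  contDiffOn : ContDiffOn ℝ n f Ω
  dbar_eq_zero : ∀ I ∈ imagUnits, ∀ q ∈ Ω ∩ slicePlane I, (dbar I)^[n] f q = 0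

/-- The imaginary units `e₁ = i`, `e₂ = j`, `e₃ = k`. -/
def e1 : ℍ := ⟨0, 1, 0, 0⟩
/-- The imaginary unit `j`. -/
def e2 : ℍ := ⟨0, 0, 1, 0⟩
/-- The imaginary unit `k`. -/
def e3 : ℍ := ⟨0, 0, 0, 1⟩

/-- The partial derivative `∂/∂x₀`; `pd1`, `pd2`, `pd3` are those in `x₁`, `x₂`, `x₃`. -/
def pd0 (f : ℍ → ℍ) (q : ℍ) : ℍ := lineDeriv ℝ f q 1
/-- The partial derivative `∂/∂x₁`. -/
def pd1 (f : ℍ → ℍ) (q : ℍ) : ℍ := lineDeriv ℝ f q e1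
/-- The partial derivative `∂/∂x₂`. -/
def pd2 (f : ℍ → ℍ) (q : ℍ) : ℍ := lineDeriv ℝ f q e2
/-- The partial derivative `∂/∂x₃`. -/
def pd3 (f : ℍ → ℍ) (q : ℍ) : ℍ := lineDeriv ℝ f q e3

/-- The Cauchy-Fueter operator `∂₀ + i ∂₁ + j ∂₂ + k ∂₃`. -/
def cauchyFueter (f : ℍ → ℍ) (q : ℍ) : ℍ :=
  pd0 f q + e1 * pd1 f q + e2 * pd2 f q + e3 * pd3 f q

/-- (Left) Fueter regular functions on `U`. -/
def IsFueterRegularOn (f : ℍ → ℍ) (U : Set ℍ) : Prop :=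
  ContDiffOn ℝ 1 f U ∧ ∀ q ∈ U, cauchyFueter f q = 0

/-- The expression of the global operator `V` off the real axis:
`∂₀ f + (q⃗ / |q⃗|²) ∑ l, x_l ∂_l f`. -/
def rawV (f : ℍ → ℍ) (q : ℍ) : ℍ :=
  pd0 f q + (‖q.im‖ ^ 2)⁻¹ • (q.im * (q.imI • pd1 f q + q.imJ • pd2 f q + q.imK • pd3 f q))

/-- The global operator `V` on `Ω`: the extension by limits to `Ω` of `rawV f`, considered on
`Ω \ ℝ`. -/
def globalV (Ω : Set ℍ) (f : ℍ → ℍ) : ℍ → ℍ :=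
  extendFrom (Ω \ realAxis) (rawV f)

/-- `V ^ k f`. -/
def powV (Ω : Set ℍ) (k : ℕ) (f : ℍ → ℍ) : ℍ → ℍ := (globalV Ω)^[k] f

/-- `V ^ k f` is a function on `Ω`: at every stage the previous iterate is of class `C¹` on
`Ω \ ℝ`, and the next one is a continuous extension to `Ω` of the expression `rawV` of it on
`Ω \ ℝ`. -/
def PowVDefinedOn (Ω : Set ℍ) (k : ℕ) (f : ℍ → ℍ) : Prop :=
  ∀ m < k, ContDiffOn ℝ 1 (powV Ω m f) (Ω \ realAxis) ∧
    ContinuousOn (powV Ω (m + 1) f) Ω ∧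
    Set.EqOn (powV Ω (m + 1) f) (rawV (powV Ω m f)) (Ω \ realAxis)

/-- The poly-Fueter map `τ_n = Δ ∘ V ^ (n - 1)`, for `n ≥ 1`. -/
def tau (Ω : Set ℍ) (n : ℕ) (f : ℍ → ℍ) : ℍ → ℍ := Laplacian.laplacian (powV Ω (n - 1) f)

end PolyFueter

end

/-!
# The Fueter mapping theorem for slice polyanalytic functions

Almansi decomposition. On the slice `ℂ_i`, a slice polyanalytic function of order `n` is a pair of
complex valued functions annihilated by the `n`-th power of the Wirtinger operator, hence a
polynomial of degree less than `n` in `x` with holomorphic coefficients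
(`exists_holomorphic_decomposition`). As a slice function is determined by its values on one slice
(`IsSliceFunctionOn.eqOn`), it follows that `f = ∑ k < n, x₀ ^ k h_k` on `Ω`, where each `h_k` is
the slice extension of a holomorphic function (`IsSlicePolyanalyticOn.exists_decomposition`).

Smoothness. The coefficients are combinations, with constants on the right, of functions
`sliceExt w` with `w` holomorphic and `w (conj z) = conj (w z)`. Near a real point such a `w` is the
sum of a power series with real coefficients, and `sliceExt w` is the sum of the same series in the
quaternionic variable (`analyticAt_sliceExt_of_real`), so it is smooth across the real axis.

The operator `V`. Off the real axis `V` annihilates `sliceExt w` (`rawV_sliceExt`) and is a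
derivation on products with functions of `x₀`. Hence `V ^ m f = ∑ k, (x₀ ^ k)^(m) h_k`, with the
derivatives of order `m` of the monomials, which is smooth on `Ω`, and
`V ^ (n - 1) f = (n - 1)! h_(n-1)`.

Fueter's theorem. With `q = x + q⃗` and `r = |q⃗|`, the Cauchy-Fueter operator sends `sliceExt w` to
`-2 Im w (x + i r) / r` (`cauchyFueter_sliceExt`), and `w (x + i r) / r` is harmonic in `ℝ⁴` off the
real axis (`laplacian_comp_sliceCoord_mul_inv`). Since the Laplacian commutes with the
Cauchy-Fueter operator, `Δ (sliceExt w)` is Fueter regular off the real axis, and on all of `Ω` by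
continuity.
-/

open scoped Quaternion ContDiff Topology

noncomputable section

namespace PolyFueter

open Filter Complex

/-! ### Line derivatives, the Laplacian and the Cauchy-Fueter operator -/

section LineDeriv

variable {E F G : Type*} [NormedAddCommGroup E] [NormedSpace ℝ E] [NormedAddCommGroup F]
  [NormedSpace ℝ F] [NormedAddCommGroup G] [NormedSpace ℝ G]

lemma lineDeriv_eventuallyEq_fderiv {f : E → F} {q : E} (hf : ContDiffAt ℝ 1 f q) (v : E) :
    (fun p => lineDeriv ℝ f p v) =ᶠ[𝓝 q] fun p => fderiv ℝ f p v := by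
  filter_upwards [hf.eventually (by simp)] with p hp
  exact (hp.differentiableAt (by simp)).lineDeriv_eq_fderiv

lemma contDiffAt_lineDeriv {f : E → F} {q : E} {n : ℕ} (hf : ContDiffAt ℝ (n + 1) f q) (v : E) :
    ContDiffAt ℝ n (fun p => lineDeriv ℝ f p v) q := by
  refine ContDiffAt.congr_of_eventuallyEq ?_
    (lineDeriv_eventuallyEq_fderiv (hf.of_le (by norm_cast; omega)) v)
  exact (hf.fderiv_right (m := n) le_rfl).clm_apply contDiffAt_const

lemma lineDeriv_comm {f : E → F} {q : E} (hf : ContDiffAt ℝ 2 f q) (v w : E) :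
    lineDeriv ℝ (fun p => lineDeriv ℝ f p v) q w =
      lineDeriv ℝ (fun p => lineDeriv ℝ f p w) q v := by
  have h1 : ContDiffAt ℝ 1 f q := hf.of_le (by norm_num)
  have hd : DifferentiableAt ℝ (fderiv ℝ f) q :=
    (hf.fderiv_right (m := 1) (by norm_num)).differentiableAt (by simp)
  have key (a b : E) : lineDeriv ℝ (fun p => lineDeriv ℝ f p a) q b =
      fderiv ℝ (fderiv ℝ f) q b a := by
    rw [(lineDeriv_eventuallyEq_fderiv h1 a).lineDeriv_eq,
      (hd.clm_apply (differentiableAt_const a)).lineDeriv_eq_fderiv,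
      fderiv_clm_apply hd (differentiableAt_const a)]
    simp
  rw [key, key]
  exact (hf.isSymmSndFDerivAt (by simp)).eq _ _

lemma lineDeriv_finsetSum {ι : Type*} {s : Finset ι} {f : ι → E → F} {q : E}
    (hf : ∀ i ∈ s, DifferentiableAt ℝ (f i) q) (v : E) :
    lineDeriv ℝ (fun p => ∑ i ∈ s, f i p) q v = ∑ i ∈ s, lineDeriv ℝ (f i) q v := by
  rw [(DifferentiableAt.fun_sum hf).lineDeriv_eq_fderiv, fderiv_fun_sum hf]
  simp only [sum_apply]
  exact Finset.sum_congr rfl fun i hi => ((hf i hi).lineDeriv_eq_fderiv).symm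

lemma lineDeriv_clm_comp {f : E → F} {q : E} (T : F →L[ℝ] G) (hf : DifferentiableAt ℝ f q)
    (v : E) : lineDeriv ℝ (fun p => T (f p)) q v = T (lineDeriv ℝ f q v) := by
  have h : HasLineDerivAt ℝ (fun p => T (f p)) (T (lineDeriv ℝ f q v)) q v :=
    T.hasFDerivAt.comp_hasDerivAt 0 hf.lineDifferentiableAt.hasLineDerivAt
  exact h.lineDeriv

end LineDeriv

/-- The standard orthonormal basis `1, i, j, k` of `ℍ`. -/
def stdBasis : OrthonormalBasis (Fin 4) ℝ ℍ :=
  OrthonormalBasis.ofRepr Quaternion.linearIsometryEquivTuple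

lemma coe_stdBasis : ⇑stdBasis = ![1, e1, e2, e3] := by
  funext i
  have : stdBasis i = (⟨EuclideanSpace.single i (1 : ℝ) 0, EuclideanSpace.single i (1 : ℝ) 1,
      EuclideanSpace.single i (1 : ℝ) 2, EuclideanSpace.single i (1 : ℝ) 3⟩ : ℍ) :=
    (stdBasis.repr_symm_single i).symm
  rw [this]
  fin_cases i <;> ext <;> simp [e1, e2, e3]

lemma cauchyFueter_eq_sum (f : ℍ → ℍ) (q : ℍ) :
    cauchyFueter f q = ∑ i, stdBasis i * lineDeriv ℝ f q (stdBasis i) := by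
  simp [coe_stdBasis, Fin.sum_univ_four, cauchyFueter, pd0, pd1, pd2, pd3]

lemma laplacian_eq_sum_lineDeriv {F : Type*} [NormedAddCommGroup F] [NormedSpace ℝ F]
    {f : ℍ → F} {q : ℍ} (hf : ContDiffAt ℝ 2 f q) :
    Laplacian.laplacian f q =
      ∑ i, lineDeriv ℝ (fun p => lineDeriv ℝ f p (stdBasis i)) q (stdBasis i) := by
  rw [InnerProductSpace.laplacian_eq_iteratedFDeriv_orthonormalBasis f stdBasis]
  refine Finset.sum_congr rfl fun i _ => ?_
  have hd : DifferentiableAt ℝ (fderiv ℝ f) q :=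
    (hf.fderiv_right (m := 1) (by norm_num)).differentiableAt (by simp)
  rw [(lineDeriv_eventuallyEq_fderiv (hf.of_le (by norm_num)) _).lineDeriv_eq,
    (hd.clm_apply (differentiableAt_const _)).lineDeriv_eq_fderiv,
    fderiv_clm_apply hd (differentiableAt_const _), iteratedFDeriv_two_apply]
  simp

lemma laplacian_eventuallyEq_sum_lineDeriv {F : Type*} [NormedAddCommGroup F] [NormedSpace ℝ F]
    {f : ℍ → F} {q : ℍ} (hf : ContDiffAt ℝ 2 f q) :
    Laplacian.laplacian f =ᶠ[𝓝 q]
      fun p => ∑ i, lineDeriv ℝ (fun p => lineDeriv ℝ f p (stdBasis i)) p (stdBasis i) := by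
  filter_upwards [hf.eventually (by simp)] with p hp using laplacian_eq_sum_lineDeriv hp

lemma contDiffAt_laplacian {F : Type*} [NormedAddCommGroup F] [NormedSpace ℝ F]
    {f : ℍ → F} {q : ℍ} {n : ℕ} (hf : ContDiffAt ℝ (n + 2) f q) :
    ContDiffAt ℝ n (Laplacian.laplacian f) q := by
  refine ContDiffAt.congr_of_eventuallyEq ?_
    (laplacian_eventuallyEq_sum_lineDeriv (hf.of_le (by norm_cast; omega)))
  refine ContDiffAt.sum fun i _ => contDiffAt_lineDeriv (contDiffAt_lineDeriv (n := n + 1) ?_ _) _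
  exact_mod_cast hf

lemma contDiffAt_cauchyFueter {f : ℍ → ℍ} {q : ℍ} {n : ℕ} (hf : ContDiffAt ℝ (n + 1) f q) :
    ContDiffAt ℝ n (cauchyFueter f) q := by
  rw [show cauchyFueter f = _ from funext (cauchyFueter_eq_sum f)]
  exact ContDiffAt.sum fun i _ => contDiffAt_const.mul (contDiffAt_lineDeriv hf _)

/-- Constant coefficient operators commute on functions of class `C³`. -/
lemma cauchyFueter_laplacian {f : ℍ → ℍ} {q : ℍ} (hf : ContDiffAt ℝ 3 f q) :
    cauchyFueter (Laplacian.laplacian f) q = Laplacian.laplacian (cauchyFueter f) q := by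
  have hf2 : ContDiffAt ℝ 2 f q := hf.of_le (by norm_num)
  have hev3 := hf.eventually (by simp)
  have h1 (v : ℍ) : ContDiffAt ℝ 2 (fun p => lineDeriv ℝ f p v) q :=
    contDiffAt_lineDeriv (n := 2) hf v
  have hd (v w : ℍ) : DifferentiableAt ℝ
      (fun p => lineDeriv ℝ (fun p => lineDeriv ℝ f p v) p w) q :=
    (contDiffAt_lineDeriv (n := 1) (h1 v) w).differentiableAt (by simp)
  rw [laplacian_eq_sum_lineDeriv (contDiffAt_cauchyFueter (n := 2) hf), cauchyFueter_eq_sum]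
  have hL (l : Fin 4) : lineDeriv ℝ (Laplacian.laplacian f) q (stdBasis l) =
      ∑ m, lineDeriv ℝ (fun p => lineDeriv ℝ (fun p => lineDeriv ℝ f p (stdBasis m)) p
        (stdBasis m)) q (stdBasis l) := by
    rw [(laplacian_eventuallyEq_sum_lineDeriv hf2).lineDeriv_eq,
      lineDeriv_finsetSum fun i _ => hd _ _]
  have hR (m : Fin 4) : lineDeriv ℝ (fun p => lineDeriv ℝ (cauchyFueter f) p (stdBasis m)) q
      (stdBasis m) = ∑ l, stdBasis l * lineDeriv ℝ (fun p => lineDeriv ℝ (fun p =>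
        lineDeriv ℝ f p (stdBasis l)) p (stdBasis m)) q (stdBasis m) := by
    have : (fun p => lineDeriv ℝ (cauchyFueter f) p (stdBasis m)) =ᶠ[𝓝 q] fun p =>
        ∑ l, stdBasis l * lineDeriv ℝ (fun p => lineDeriv ℝ f p (stdBasis l)) p (stdBasis m) := by
      filter_upwards [hev3] with p hp
      have hdp (v : ℍ) : DifferentiableAt ℝ (fun p => lineDeriv ℝ f p v) p :=
        (contDiffAt_lineDeriv (n := 2) hp v).differentiableAt (by simp)
      rw [show cauchyFueter f = _ from funext (cauchyFueter_eq_sum f),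
        lineDeriv_finsetSum fun i _ => (hdp _).const_mul _]
      exact Finset.sum_congr rfl fun l _ =>
        lineDeriv_clm_comp (ContinuousLinearMap.mul ℝ ℍ (stdBasis l)) (hdp _) _
    rw [this.lineDeriv_eq, lineDeriv_finsetSum fun i _ => (hd _ _).const_mul _]
    exact Finset.sum_congr rfl fun l _ =>
      lineDeriv_clm_comp (ContinuousLinearMap.mul ℝ ℍ (stdBasis l)) (hd _ _) _
  simp only [hL, hR, Finset.mul_sum]
  rw [Finset.sum_comm]
  refine Finset.sum_congr rfl fun m _ => Finset.sum_congr rfl fun l _ => ?_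
  rw [lineDeriv_comm (h1 _)]
  congr 1
  refine Filter.EventuallyEq.lineDeriv_eq ?_
  filter_upwards [hf2.eventually (by simp)] with p hp using lineDeriv_comm hp _ _

/-! ### Polyanalytic functions of a complex variable -/

/-- The Wirtinger operator `(1 / 2) (∂/∂x + i ∂/∂y)` on functions of a complex variable. -/
def wirtinger (u : ℂ → ℂ) (z : ℂ) : ℂ :=
  (1 / 2 : ℝ) • (lineDeriv ℝ u z 1 + I * lineDeriv ℝ u z I)

section Wirtinger

variable {U : Set ℂ} {u v : ℂ → ℂ}

lemma wirtinger_eq_fderiv {z : ℂ} (hu : DifferentiableAt ℝ u z) :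
    wirtinger u z = (1 / 2 : ℝ) • (fderiv ℝ u z 1 + I * fderiv ℝ u z I) := by
  rw [wirtinger, hu.lineDeriv_eq_fderiv, hu.lineDeriv_eq_fderiv]

lemma wirtinger_sub {z : ℂ} (hu : DifferentiableAt ℝ u z) (hv : DifferentiableAt ℝ v z) :
    wirtinger (fun z => u z - v z) z = wirtinger u z - wirtinger v z := by
  rw [wirtinger_eq_fderiv hu, wirtinger_eq_fderiv hv, wirtinger_eq_fderiv (hu.fun_sub hv),
    fderiv_fun_sub hu hv]
  simp
  ring

lemma wirtinger_congr {z : ℂ} (h : u =ᶠ[𝓝 z] v) : wirtinger u z = wirtinger v z := by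
  rw [wirtinger, wirtinger, h.lineDeriv_eq, h.lineDeriv_eq]

lemma contDiffOn_wirtinger (hU : IsOpen U) {n : ℕ} (hu : ContDiffOn ℝ (n + 1) u U) :
    ContDiffOn ℝ n (wirtinger u) U := fun z hz => by
  have h := hu.contDiffAt (hU.mem_nhds hz)
  exact (((contDiffAt_lineDeriv h 1).add
    (contDiffAt_const.mul (contDiffAt_lineDeriv h I))).const_smul _).contDiffWithinAt

lemma contDiffOn_iterate_wirtinger (hU : IsOpen U) {n m : ℕ}
    (hu : ContDiffOn ℝ (n + m : ℕ) u U) : ContDiffOn ℝ n (wirtinger^[m] u) U := by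
  induction m generalizing u with
  | zero => simpa using hu
  | succ m ih => exact ih (contDiffOn_wirtinger hU (by exact_mod_cast hu))

lemma iterate_wirtinger_sub (hU : IsOpen U) {m : ℕ} (hu : ContDiffOn ℝ m u U)
    (hv : ContDiffOn ℝ m v U) :
    Set.EqOn (wirtinger^[m] fun z => u z - v z) (fun z => wirtinger^[m] u z - wirtinger^[m] v z)
      U := by
  induction m with
  | zero => exact fun z _ => rfl
  | succ m ih =>
    intro z hz
    have hd {w : ℂ → ℂ} (hw : ContDiffOn ℝ (m + 1 : ℕ) w U) :
        DifferentiableAt ℝ (wirtinger^[m] w) z :=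
      ((contDiffOn_iterate_wirtinger hU (n := 1) (by rwa [add_comm])).contDiffAt
        (hU.mem_nhds hz)).differentiableAt (by simp)
    simp only [Function.iterate_succ_apply']
    rw [wirtinger_congr ((ih (hu.of_le (by norm_cast; omega))
      (hv.of_le (by norm_cast; omega))).eventuallyEq_of_mem (hU.mem_nhds hz)),
      wirtinger_sub (hd hu) (hd hv)]

/-- The kernel of the Wirtinger operator consists of the holomorphic functions. -/
lemma differentiableAt_of_wirtinger_eq_zero {z : ℂ} (hu : DifferentiableAt ℝ u z)
    (h : wirtinger u z = 0) : DifferentiableAt ℂ u z := by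
  rw [differentiableAt_complex_iff_differentiableAt_real]
  refine ⟨hu, ?_⟩
  rw [wirtinger_eq_fderiv hu, smul_eq_zero_iff_right (by norm_num)] at h
  rw [smul_eq_mul]
  linear_combination (-I) * h + fderiv ℝ u z I * I_mul_I

lemma wirtinger_const_mul_re_pow_mul {h : ℂ → ℂ} {z : ℂ} (hh : DifferentiableAt ℂ h z) (c : ℂ)
    (k : ℕ) : wirtinger (fun z => c * (z.re : ℂ) ^ k * h z) z =
      c * (k / 2) * (z.re : ℂ) ^ (k - 1) * h z := by
  have hr (v : ℂ) : HasLineDerivAt ℝ (fun z : ℂ => ((z.re : ℝ) : ℂ)) (v.re : ℂ) z v := by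
    have : HasFDerivAt (fun z : ℂ => ((z.re : ℝ) : ℂ)) (ofRealCLM.comp reCLM) z :=
      (ofRealCLM.comp reCLM).hasFDerivAt
    simpa using this.hasLineDerivAt v
  have hl (v : ℂ) : HasLineDerivAt ℝ h (v * deriv h z) z v := by
    simpa using (hh.hasDerivAt.hasFDerivAt.restrictScalars ℝ).hasLineDerivAt v
  have key (v : ℂ) : lineDeriv ℝ (fun z => c * (z.re : ℂ) ^ k * h z) z v =
      c * (k * (z.re : ℂ) ^ (k - 1) * v.re) * h z + c * (z.re : ℂ) ^ k * (v * deriv h z) := by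
    have := (((HasDerivAt.fun_pow (hr v) k).const_mul c).mul (hl v))
    simp only [zero_smul, add_zero] at this
    exact HasLineDerivAt.lineDeriv this
  rw [wirtinger, key, key, real_smul]
  simp only [one_re, I_re, ofReal_one, ofReal_zero]
  push_cast
  linear_combination (1 / 2 * (c * (z.re : ℂ) ^ k * deriv h z)) * I_mul_I

lemma iterate_wirtinger_const_mul_re_pow_mul (hU : IsOpen U) {h : ℂ → ℂ}
    (hh : DifferentiableOn ℂ h U) (c : ℂ) (k m : ℕ) :
    Set.EqOn (wirtinger^[m] fun z => c * (z.re : ℂ) ^ k * h z)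
      (fun z => c * (k.descFactorial m / 2 ^ m) * (z.re : ℂ) ^ (k - m) * h z) U := by
  induction m with
  | zero => intro z _; simp
  | succ m ih =>
    intro z hz
    rw [Function.iterate_succ_apply', wirtinger_congr (ih.eventuallyEq_of_mem (hU.mem_nhds hz)),
      wirtinger_const_mul_re_pow_mul (hh.differentiableAt (hU.mem_nhds hz)),
      Nat.descFactorial_succ, Nat.sub_sub]
    push_cast
    ring

/-- A polyanalytic function of order `n` is a polynomial of degree less than `n` in `Re z` with
holomorphic coefficients. The top coefficient is, up to a constant, the iterate of order `n - 1` of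
the Wirtinger operator; removing it lowers the order. -/
lemma exists_holomorphic_decomposition (hU : IsOpen U) {n : ℕ} (hu : ContDiffOn ℝ n u U)
    (h0 : ∀ z ∈ U, wirtinger^[n] u z = 0) :
    ∃ h : ℕ → ℂ → ℂ, (∀ k, DifferentiableOn ℂ (h k) U) ∧
      ∀ z ∈ U, u z = ∑ k ∈ Finset.range n, (z.re : ℂ) ^ k * h k z := by
  induction n generalizing u with
  | zero => exact ⟨0, fun k => differentiableOn_const 0, fun z hz => by simpa using h0 z hz⟩
  | succ n ih =>
    set g := wirtinger^[n] u with hg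
    have hgh : DifferentiableOn ℂ g U := fun z hz => by
      refine (differentiableAt_of_wirtinger_eq_zero ?_ ?_).differentiableWithinAt
      · exact ((contDiffOn_iterate_wirtinger hU (n := 1) (by rwa [add_comm])).contDiffAt
          (hU.mem_nhds hz)).differentiableAt (by simp)
      · simpa only [Function.iterate_succ_apply'] using h0 z hz
    have hgs : ContDiffOn ℝ n g U := (hgh.contDiffOn hU).restrict_scalars ℝ
    have hre : ContDiff ℝ n (fun z : ℂ => (z.re : ℂ)) := (ofRealCLM.comp reCLM).contDiff
    have hun : ContDiffOn ℝ n u U := hu.of_le (by norm_cast; omega)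
    have hc : (n.factorial : ℂ) ≠ 0 := by exact_mod_cast n.factorial_ne_zero
    have htop : ContDiffOn ℝ n (fun z : ℂ => (2 ^ n / n.factorial : ℂ) * (z.re : ℂ) ^ n * g z) U :=
      (contDiff_const.mul (hre.pow n)).contDiffOn.mul hgs
    obtain ⟨h, hh, hsum⟩ := ih (u := fun z => u z - (2 ^ n / n.factorial : ℂ) * (z.re : ℂ) ^ n * g z)
      (hun.sub htop) (fun z hz => by
        rw [iterate_wirtinger_sub hU hun htop hz]
        beta_reduce
        rw [iterate_wirtinger_const_mul_re_pow_mul hU hgh _ _ _ hz, Nat.descFactorial_self,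
          Nat.sub_self, ← hg]
        field_simp
        ring)
    refine ⟨Function.update h n fun z => (2 ^ n / n.factorial : ℂ) * g z, fun k => ?_,
      fun z hz => ?_⟩
    · rcases eq_or_ne k n with rfl | hk
      · simpa using hgh.const_mul _
      · simpa [Function.update_of_ne hk] using hh k
    · rw [Finset.sum_range_succ, Function.update_self,
        Finset.sum_congr rfl fun k hk => by
          rw [Function.update_of_ne (Finset.mem_range.1 hk).ne], ← hsum z hz]
      ring

end Wirtinger

/-! ### Slice extension of a function of a complex variable -/

/-- The real part, as a continuous linear map. -/
def quatReCLM : ℍ →L[ℝ] ℝ where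
  toFun q := q.re
  map_add' _ _ := rfl
  map_smul' _ _ := rfl
  cont := Quaternion.continuous_re

/-- The imaginary part, as a continuous linear map. -/
def quatImCLM : ℍ →L[ℝ] ℍ where
  toFun q := q.im
  map_add' _ _ := by simp
  map_smul' _ _ := by simp
  cont := Quaternion.continuous_im

lemma norm_im_sq (q : ℍ) : ‖q.im‖ ^ 2 = q.imI ^ 2 + q.imJ ^ 2 + q.imK ^ 2 := by
  rw [sq, ← Quaternion.normSq_eq_norm_mul_self, Quaternion.normSq_def']
  simp

@[simp] lemma e1_re : e1.re = 0 := rfl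
@[simp] lemma e1_imI : e1.imI = 1 := rfl
@[simp] lemma e1_imJ : e1.imJ = 0 := rfl
@[simp] lemma e1_imK : e1.imK = 0 := rfl
@[simp] lemma e2_re : e2.re = 0 := rfl
@[simp] lemma e2_imI : e2.imI = 0 := rfl
@[simp] lemma e2_imJ : e2.imJ = 1 := rfl
@[simp] lemma e2_imK : e2.imK = 0 := rfl
@[simp] lemma e3_re : e3.re = 0 := rfl
@[simp] lemma e3_imI : e3.imI = 0 := rfl
@[simp] lemma e3_imJ : e3.imJ = 0 := rfl
@[simp] lemma e3_imK : e3.imK = 1 := rfl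

/-- The inner product of the imaginary parts. -/
def imDot (p q : ℍ) : ℝ := p.imI * q.imI + p.imJ * q.imJ + p.imK * q.imK

/-- The point `x + i |q⃗|` of the closed upper half plane that belongs to `q = x + q⃗`. -/
def sliceCoord (q : ℍ) : ℂ := ⟨q.re, ‖q.im‖⟩

lemma sliceCoord_eq (q : ℍ) : sliceCoord q = (q.re : ℂ) + (‖q.im‖ : ℂ) * I := by
  rw [mul_comm]; exact Complex.ext (by simp [sliceCoord]) (by simp [sliceCoord])

/-- The function `x + y J ↦ Re w (x + i y) + J Im w (x + i y)`, where `J ∈ 𝕊` and `y ≥ 0`. On the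
real axis, where `J` is not determined, the second summand is zero. -/
def sliceExt (w : ℂ → ℂ) (q : ℍ) : ℍ :=
  ((w (sliceCoord q)).re : ℍ) + ((w (sliceCoord q)).im * ‖q.im‖⁻¹) • q.im

section Derivatives

variable {w : ℂ → ℂ} {q : ℍ}

lemma hasLineDerivAt_imDot (q u v : ℍ) : HasLineDerivAt ℝ (fun p => imDot p u) (imDot v u) q v := by
  have h : HasDerivAt (fun t : ℝ => imDot q u + t * imDot v u) (imDot v u) 0 := by
    simpa using ((hasDerivAt_id (0 : ℝ)).mul_const (imDot v u)).const_add (imDot q u)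
  refine h.congr_of_eventuallyEq (.of_forall fun t => ?_)
  simp [imDot]
  ring

lemma hasLineDerivAt_norm_im (hq : q.im ≠ 0) (v : ℍ) :
    HasLineDerivAt ℝ (fun p => ‖p.im‖) (imDot q v * ‖q.im‖⁻¹) q v := by
  have hr : ‖q.im‖ ≠ 0 := norm_ne_zero_iff.2 hq
  have h : HasDerivAt (fun t : ℝ => ‖q.im‖ ^ 2 + 2 * t * imDot q v + t ^ 2 * imDot v v)
      (2 * imDot q v) 0 := by
    simpa using ((((hasDerivAt_id (0 : ℝ)).const_mul 2).mul_const (imDot q v)).const_add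
      (‖q.im‖ ^ 2)).fun_add (((hasDerivAt_id (0 : ℝ)).fun_pow 2).mul_const (imDot v v))
  have h2 := h.sqrt (by simpa using hr)
  simp only [mul_zero, zero_mul, add_zero, ne_eq, OfNat.ofNat_ne_zero, not_false_eq_true,
    zero_pow, Real.sqrt_sq (norm_nonneg _)] at h2
  rw [show imDot q v * ‖q.im‖⁻¹ = 2 * imDot q v / (2 * ‖q.im‖) by field_simp]
  refine h2.congr_of_eventuallyEq (.of_forall fun t => ?_)
  beta_reduce
  rw [← Real.sqrt_sq (norm_nonneg (q + t • v).im), norm_im_sq, norm_im_sq]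
  congr 1
  simp [imDot]
  ring

lemma hasLineDerivAt_comp_sliceCoord (hw : DifferentiableAt ℂ w (sliceCoord q)) (hq : q.im ≠ 0)
    (v : ℍ) : HasLineDerivAt ℝ (fun p => w (sliceCoord p))
      (deriv w (sliceCoord q) * (v.re + imDot q v * (‖q.im‖ : ℂ)⁻¹ * I)) q v := by
  have hre : HasDerivAt (fun t : ℝ => (q + t • v).re) v.re 0 := by
    simpa using ((hasDerivAt_id (0 : ℝ)).mul_const v.re).const_add q.re
  have hz : HasDerivAt (fun t : ℝ => sliceCoord (q + t • v))
      (v.re + imDot q v * (‖q.im‖ : ℂ)⁻¹ * I) 0 := by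
    have h2 : HasDerivAt (fun t : ℝ => ‖(q + t • v).im‖) (imDot q v * ‖q.im‖⁻¹) 0 :=
      hasLineDerivAt_norm_im hq v
    simp only [sliceCoord_eq]
    simpa using hre.ofReal_comp.fun_add (h2.ofReal_comp.mul_const I)
  have := HasDerivAt.scomp_of_eq (0 : ℝ) hw.hasDerivAt hz (by simp)
  rw [smul_eq_mul, mul_comm] at this
  exact this

lemma contDiffAt_norm_im (hq : q.im ≠ 0) {n : ℕ∞ω} : ContDiffAt ℝ n (fun p : ℍ => ‖p.im‖) q :=
  (contDiffAt_norm ℝ hq).comp q quatImCLM.contDiff.contDiffAt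

lemma contDiffAt_comp_sliceCoord (hw : AnalyticAt ℂ w (sliceCoord q)) (hq : q.im ≠ 0) {n : ℕ∞ω} :
    ContDiffAt ℝ n (fun p => w (sliceCoord p)) q := by
  have hz : ContDiffAt ℝ n sliceCoord q := by
    rw [funext sliceCoord_eq]
    exact (ofRealCLM.contDiff.contDiffAt.comp q quatReCLM.contDiff.contDiffAt).add
      ((ofRealCLM.contDiff.contDiffAt.comp q (contDiffAt_norm_im hq)).mul contDiffAt_const)
  exact (hw.contDiffAt.restrict_scalars ℝ).comp q hz

lemma contDiffAt_sliceExt_of_im_ne_zero (hw : AnalyticAt ℂ w (sliceCoord q)) (hq : q.im ≠ 0)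
    {n : ℕ∞ω} : ContDiffAt ℝ n (sliceExt w) q := by
  have hW := contDiffAt_comp_sliceCoord hw hq (n := n)
  have h1 : ContDiffAt ℝ n (fun p => (w (sliceCoord p)).re) q :=
    reCLM.contDiff.contDiffAt.comp q hW
  have h2 : ContDiffAt ℝ n (fun p => (w (sliceCoord p)).im) q :=
    imCLM.contDiff.contDiffAt.comp q hW
  exact ((Algebra.linearMap ℝ ℍ).toContinuousLinearMap.contDiff.contDiffAt.comp q h1).add
    ((h2.mul ((contDiffAt_norm_im hq).inv (norm_ne_zero_iff.2 hq))).smul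
      quatImCLM.contDiff.contDiffAt)

lemma eventually_im_ne_zero (hq : q.im ≠ 0) : ∀ᶠ p : ℍ in 𝓝 q, p.im ≠ 0 :=
  Quaternion.continuous_im.continuousAt.eventually_ne hq

lemma eventually_analyticAt_sliceCoord (hw : AnalyticAt ℂ w (sliceCoord q)) :
    ∀ᶠ p in 𝓝 q, AnalyticAt ℂ w (sliceCoord p) := by
  have hc : Continuous sliceCoord := by
    rw [funext sliceCoord_eq]
    exact (continuous_ofReal.comp Quaternion.continuous_re).add
      ((continuous_ofReal.comp Quaternion.continuous_im.norm).mul continuous_const)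
  exact hc.continuousAt.eventually hw.eventually_analyticAt

lemma lineDeriv_comp_sliceCoord_mul_inv (hw : DifferentiableAt ℂ w (sliceCoord q)) (hq : q.im ≠ 0)
    (v : ℍ) : lineDeriv ℝ (fun p => w (sliceCoord p) * (‖p.im‖ : ℂ)⁻¹) q v =
      deriv w (sliceCoord q) * (v.re + imDot q v * (‖q.im‖ : ℂ)⁻¹ * I) * (‖q.im‖ : ℂ)⁻¹ -
        w (sliceCoord q) * imDot q v * (‖q.im‖ : ℂ)⁻¹ ^ 3 := by
  have hr : (‖q.im‖ : ℂ) ≠ 0 := by simpa using hq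
  have h1 : HasDerivAt (fun t : ℝ => w (sliceCoord (q + t • v))) _ 0 :=
    hasLineDerivAt_comp_sliceCoord hw hq v
  have h2 : HasDerivAt (fun t : ℝ => ‖(q + t • v).im‖) _ 0 := hasLineDerivAt_norm_im hq v
  have h := h1.fun_mul (h2.ofReal_comp.fun_inv (by simpa using hq))
  simp only [zero_smul, add_zero] at h
  refine h.deriv.trans ?_
  push_cast
  field_simp
  ring

/-- The second derivative along `v`, sorted by powers of `v.re` and `imDot q v`: summed over an
orthonormal basis, the four coefficients get the factors `1`, `0`, `|q⃗| ^ 2` and `3`. -/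
lemma lineDeriv_lineDeriv_comp_sliceCoord_mul_inv (hw : AnalyticAt ℂ w (sliceCoord q))
    (hq : q.im ≠ 0) (v : ℍ) :
    lineDeriv ℝ (fun p => lineDeriv ℝ (fun p => w (sliceCoord p) * (‖p.im‖ : ℂ)⁻¹) p v) q v =
      deriv (deriv w) (sliceCoord q) * (‖q.im‖ : ℂ)⁻¹ * v.re ^ 2 +
      (2 * deriv (deriv w) (sliceCoord q) * I * (‖q.im‖ : ℂ)⁻¹ ^ 2 -
        2 * deriv w (sliceCoord q) * (‖q.im‖ : ℂ)⁻¹ ^ 3) * (v.re * imDot q v) +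
      (-deriv (deriv w) (sliceCoord q) * (‖q.im‖ : ℂ)⁻¹ ^ 3 -
        3 * deriv w (sliceCoord q) * I * (‖q.im‖ : ℂ)⁻¹ ^ 4 +
        3 * w (sliceCoord q) * (‖q.im‖ : ℂ)⁻¹ ^ 5) * imDot q v ^ 2 +
      (deriv w (sliceCoord q) * I * (‖q.im‖ : ℂ)⁻¹ ^ 2 -
        w (sliceCoord q) * (‖q.im‖ : ℂ)⁻¹ ^ 3) * imDot v v := by
  have hr : (‖q.im‖ : ℂ) ≠ 0 := by simpa using hq
  have hev : (fun p => lineDeriv ℝ (fun p => w (sliceCoord p) * (‖p.im‖ : ℂ)⁻¹) p v) =ᶠ[𝓝 q]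
      fun p => deriv w (sliceCoord p) * (v.re + imDot p v * (‖p.im‖ : ℂ)⁻¹ * I) * (‖p.im‖ : ℂ)⁻¹ -
        w (sliceCoord p) * imDot p v * (‖p.im‖ : ℂ)⁻¹ ^ 3 := by
    filter_upwards [eventually_im_ne_zero hq, eventually_analyticAt_sliceCoord hw] with p hp hwp
    exact lineDeriv_comp_sliceCoord_mul_inv hwp.differentiableAt hp v
  rw [hev.lineDeriv_eq]
  have h0 : HasDerivAt (fun t : ℝ => w (sliceCoord (q + t • v))) _ 0 :=
    hasLineDerivAt_comp_sliceCoord hw.differentiableAt hq v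
  have h1 : HasDerivAt (fun t : ℝ => deriv w (sliceCoord (q + t • v))) _ 0 :=
    hasLineDerivAt_comp_sliceCoord hw.deriv.differentiableAt hq v
  have h2 : HasDerivAt (fun t : ℝ => ‖(q + t • v).im‖) _ 0 := hasLineDerivAt_norm_im hq v
  have h3 : HasDerivAt (fun t : ℝ => imDot (q + t • v) v) _ 0 := hasLineDerivAt_imDot q v v
  have hinv := h2.ofReal_comp.fun_inv (by simpa using hq)
  have h := ((h1.fun_mul (((h3.ofReal_comp.fun_mul hinv).mul_const I).const_add (v.re : ℂ))).fun_mul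
    hinv).fun_sub ((h0.fun_mul h3.ofReal_comp).fun_mul (hinv.fun_pow 3))
  simp only [zero_smul, add_zero] at h
  refine h.deriv.trans ?_
  push_cast
  field_simp
  ring_nf
  simp only [I_sq]
  ring

/-- If `w` is holomorphic, `w (x + i |q⃗|) / |q⃗|` is harmonic off the real axis of `ℍ = ℝ⁴`. -/
lemma laplacian_comp_sliceCoord_mul_inv (hw : AnalyticAt ℂ w (sliceCoord q)) (hq : q.im ≠ 0) :
    Laplacian.laplacian (fun p => w (sliceCoord p) * (‖p.im‖ : ℂ)⁻¹) q = 0 := by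
  have hr : (‖q.im‖ : ℂ) ≠ 0 := by simpa using hq
  have hr2 : (‖q.im‖ : ℂ) ^ 2 = q.imI ^ 2 + q.imJ ^ 2 + q.imK ^ 2 := by
    exact_mod_cast norm_im_sq q
  have hc : ContDiffAt ℝ 2 (fun p => w (sliceCoord p) * (‖p.im‖ : ℂ)⁻¹) q :=
    (contDiffAt_comp_sliceCoord hw hq).mul
      ((ofRealCLM.contDiff.contDiffAt.comp q (contDiffAt_norm_im hq)).inv hr)
  rw [laplacian_eq_sum_lineDeriv hc]
  simp only [lineDeriv_lineDeriv_comp_sliceCoord_mul_inv hw hq, coe_stdBasis, Fin.sum_univ_four]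
  simp [imDot]
  field_simp
  linear_combination (deriv (deriv w) (sliceCoord q) * (‖q.im‖ : ℂ) ^ 2 +
    3 * deriv w (sliceCoord q) * I * ‖q.im‖ - 3 * w (sliceCoord q)) * hr2

lemma lineDeriv_sliceExt (hw : DifferentiableAt ℂ w (sliceCoord q)) (hq : q.im ≠ 0) (v : ℍ) :
    lineDeriv ℝ (sliceExt w) q v =
      ((v.re * (deriv w (sliceCoord q)).re -
        (deriv w (sliceCoord q)).im * imDot q v * ‖q.im‖⁻¹ : ℝ) : ℍ) +
      ((v.re * (deriv w (sliceCoord q)).im +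
        (deriv w (sliceCoord q)).re * imDot q v * ‖q.im‖⁻¹) * ‖q.im‖⁻¹ -
          (w (sliceCoord q)).im * imDot q v * ‖q.im‖⁻¹ ^ 3) • q.im +
      ((w (sliceCoord q)).im * ‖q.im‖⁻¹) • v.im := by
  have hr : ‖q.im‖ ≠ 0 := norm_ne_zero_iff.2 hq
  have h0 : HasDerivAt (fun t : ℝ => w (sliceCoord (q + t • v))) _ 0 :=
    hasLineDerivAt_comp_sliceCoord hw hq v
  have h2 : HasDerivAt (fun t : ℝ => ‖(q + t • v).im‖) _ 0 := hasLineDerivAt_norm_im hq v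
  have hinv := h2.fun_inv (by simpa using hr)
  have hre : HasDerivAt (fun t : ℝ => (w (sliceCoord (q + t • v))).re) _ 0 :=
    reCLM.hasFDerivAt.comp_hasDerivAt 0 h0
  have him : HasDerivAt (fun t : ℝ => (w (sliceCoord (q + t • v))).im) _ 0 :=
    imCLM.hasFDerivAt.comp_hasDerivAt 0 h0
  have hv : HasDerivAt (fun t : ℝ => (q + t • v).im) v.im 0 :=
    quatImCLM.hasFDerivAt.hasLineDerivAt v
  have h := (hre.smul_const (1 : ℍ)).fun_add ((him.fun_mul hinv).fun_smul hv)
  simp only [zero_smul, add_zero] at h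
  have h' : HasLineDerivAt ℝ (sliceExt w) _ q v :=
    h.congr_of_eventuallyEq (.of_forall fun t => by
      simp [sliceExt, ← Quaternion.coe_mul_eq_smul])
  rw [h'.lineDeriv]
  simp only [reCLM_apply, imCLM_apply, mul_re, mul_im, add_re, add_im, ofReal_re, ofReal_im, I_re,
    I_im, ← ofReal_inv, ← ofReal_mul]
  rw [show -(imDot q v * ‖q.im‖⁻¹) / ‖q.im‖ ^ 2 = -imDot q v * ‖q.im‖⁻¹ ^ 3 by field_simp]
  generalize ‖q.im‖⁻¹ = ρ
  ext <;> simp <;> ring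

/-- Off the real axis `V` annihilates the slice extension of a holomorphic function. -/
lemma rawV_sliceExt (hw : DifferentiableAt ℂ w (sliceCoord q)) (hq : q.im ≠ 0) :
    rawV (sliceExt w) q = 0 := by
  have hr : ‖q.im‖ ≠ 0 := norm_ne_zero_iff.2 hq
  have hρ : ‖q.im‖⁻¹ ^ 2 * (q.imI ^ 2 + q.imJ ^ 2 + q.imK ^ 2) = 1 := by
    rw [← norm_im_sq]; field_simp
  simp only [rawV, pd0, pd1, pd2, pd3, lineDeriv_sliceExt hw hq, ← inv_pow]
  generalize ‖q.im‖⁻¹ = ρ at *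
  generalize deriv w (sliceCoord q) = d
  generalize w (sliceCoord q) = a
  ext <;> simp [imDot]
  · linear_combination (-d.re * (1 + ρ ^ 2 * (q.imI ^ 2 + q.imJ ^ 2 + q.imK ^ 2)) +
      a.im * ρ * ρ ^ 2 * (q.imI ^ 2 + q.imJ ^ 2 + q.imK ^ 2)) * hρ
  · linear_combination (-d.im * ρ * q.imI) * hρ
  · linear_combination (-d.im * ρ * q.imJ) * hρ
  · linear_combination (-d.im * ρ * q.imK) * hρ

lemma cauchyFueter_sliceExt (hw : DifferentiableAt ℂ w (sliceCoord q)) (hq : q.im ≠ 0) :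
    cauchyFueter (sliceExt w) q = ((-2 * ((w (sliceCoord q)).im * ‖q.im‖⁻¹) : ℝ) : ℍ) := by
  have hr : ‖q.im‖ ≠ 0 := norm_ne_zero_iff.2 hq
  have hρ : ‖q.im‖⁻¹ ^ 2 * (q.imI ^ 2 + q.imJ ^ 2 + q.imK ^ 2) = 1 := by
    rw [← norm_im_sq]; field_simp
  simp only [cauchyFueter, pd0, pd1, pd2, pd3, lineDeriv_sliceExt hw hq]
  generalize ‖q.im‖⁻¹ = ρ at *
  generalize deriv w (sliceCoord q) = d
  generalize w (sliceCoord q) = a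
  ext <;> simp [imDot]
  · linear_combination (-d.re + a.im * ρ) * hρ
  all_goals ring

/-- Fueter's theorem off the real axis, for the slice extension of a holomorphic function. -/
lemma cauchyFueter_laplacian_sliceExt (hw : AnalyticAt ℂ w (sliceCoord q)) (hq : q.im ≠ 0) :
    cauchyFueter (Laplacian.laplacian (sliceExt w)) q = 0 := by
  rw [cauchyFueter_laplacian (contDiffAt_sliceExt_of_im_ne_zero hw hq)]
  -- The real-linear map `z ↦ -2 Im z`, with values in the real quaternions
  set T : ℂ →L[ℝ] ℍ := (-2 : ℝ) • (Algebra.linearMap ℝ ℍ).toContinuousLinearMap.comp imCLM with hT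
  have hev : cauchyFueter (sliceExt w) =ᶠ[𝓝 q]
      T ∘ fun p => w (sliceCoord p) * (‖p.im‖ : ℂ)⁻¹ := by
    filter_upwards [eventually_im_ne_zero hq, eventually_analyticAt_sliceCoord hw] with p hp hwp
    rw [cauchyFueter_sliceExt hwp.differentiableAt hp]
    simp [hT, ← ofReal_inv, -inv_eq_zero, ← Quaternion.coe_mul_eq_smul]
  have hc : ContDiffAt ℝ 2 (fun p => w (sliceCoord p) * (‖p.im‖ : ℂ)⁻¹) q :=
    (contDiffAt_comp_sliceCoord hw hq).mul
      ((ofRealCLM.contDiff.contDiffAt.comp q (contDiffAt_norm_im hq)).inv (by simpa using hq))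
  rw [(InnerProductSpace.laplacian_congr_nhds hev).eq_of_nhds, hc.laplacian_CLM_comp_left,
    Function.comp_apply, laplacian_comp_sliceCoord_mul_inv hw hq, map_zero]

end Derivatives

/-! ### Slices, and smoothness across the real axis -/

/-- The imaginary units are the purely imaginary quaternions of norm `1`. -/
lemma mem_imagUnits_iff {J : ℍ} :
    J ∈ imagUnits ↔ J.re = 0 ∧ J.imI ^ 2 + J.imJ ^ 2 + J.imK ^ 2 = 1 := by
  constructor
  · intro h
    have h : J ^ 2 = -1 := h
    rw [sq] at h
    have h0 := congrArg QuaternionAlgebra.re h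
    have h1 := congrArg QuaternionAlgebra.imI h
    have h2 := congrArg QuaternionAlgebra.imJ h
    have h3 := congrArg QuaternionAlgebra.imK h
    simp at h0 h1 h2 h3
    have hre : J.re = 0 := by
      by_contra hne
      have k1 : J.imI = 0 := by
        have : J.re * J.imI = 0 := by linarith
        simpa [hne] using this
      have k2 : J.imJ = 0 := by
        have : J.re * J.imJ = 0 := by linarith
        simpa [hne] using this
      have k3 : J.imK = 0 := by
        have : J.re * J.imK = 0 := by linarith
        simpa [hne] using this
      rw [k1, k2, k3] at h0
      nlinarith [sq_nonneg J.re]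
    refine ⟨hre, ?_⟩
    rw [hre] at h0
    linarith
  · rintro ⟨h0, h1⟩
    change J ^ 2 = -1
    rw [sq]
    ext <;> simp [h0]
    · linarith
    all_goals ring

lemma e1_mem_imagUnits : e1 ∈ imagUnits := mem_imagUnits_iff.2 (by simp)

lemma neg_mem_imagUnits {J : ℍ} (hJ : J ∈ imagUnits) : -J ∈ imagUnits := by
  change (-J) ^ 2 = -1
  rw [neg_sq]; exact hJ

lemma mul_self_of_mem_imagUnits {J : ℍ} (hJ : J ∈ imagUnits) : J * J = -1 := by
  rw [← sq]; exact hJ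

lemma exists_imagUnit_im_eq (q : ℍ) : ∃ J ∈ imagUnits, q.im = ‖q.im‖ • J := by
  by_cases h : q.im = 0
  · exact ⟨e1, e1_mem_imagUnits, by simp [h]⟩
  · have hr : ‖q.im‖ ≠ 0 := norm_ne_zero_iff.2 h
    refine ⟨‖q.im‖⁻¹ • q.im, mem_imagUnits_iff.2 ⟨by simp, ?_⟩, by rw [smul_inv_smul₀ hr]⟩
    have := norm_im_sq q
    simp
    field_simp
    linarith

/-- Every quaternion is `x + y J` with `x + i y = sliceCoord q` and `J ∈ 𝕊`. -/
lemma exists_imagUnit_eq (q : ℍ) :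
    ∃ J ∈ imagUnits, q = ((sliceCoord q).re : ℍ) + (sliceCoord q).im • J := by
  obtain ⟨J, hJ, h⟩ := exists_imagUnit_im_eq q
  exact ⟨J, hJ, by rw [sliceCoord, ← h, Quaternion.re_add_im]⟩

lemma sliceCoord_add_smul (x y : ℝ) {J : ℍ} (hJ : J ∈ imagUnits) :
    sliceCoord ((x : ℍ) + y • J) = ⟨x, |y|⟩ := by
  obtain ⟨h0, h1⟩ := mem_imagUnits_iff.1 hJ
  have hn : ‖((x : ℍ) + y • J).im‖ ^ 2 = y ^ 2 := by
    rw [norm_im_sq]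
    simp
    linear_combination y ^ 2 * h1
  rw [sliceCoord, ← Real.sqrt_sq (norm_nonneg ((x : ℍ) + y • J).im), hn, Real.sqrt_sq_eq_abs]
  simp [h0]

lemma im_add_smul (x y : ℝ) {J : ℍ} (hJ : J ∈ imagUnits) : ((x : ℍ) + y • J).im = y • J := by
  obtain ⟨h0, -⟩ := mem_imagUnits_iff.1 hJ
  ext <;> simp [h0]

lemma coeComplex_eq (z : ℂ) : (z : ℍ) = (z.re : ℍ) + z.im • e1 := by
  ext <;> simp

/-- The intersection `Ω ∩ ℂ_i`, as a subset of `ℂ`. -/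
def sliceDomain (Ω : Set ℍ) : Set ℂ := {z | (z : ℍ) ∈ Ω}

lemma isOpen_sliceDomain {Ω : Set ℍ} (hΩ : IsOpen Ω) : IsOpen (sliceDomain Ω) :=
  hΩ.preimage Quaternion.ofComplex.toLinearMap.continuous_of_finiteDimensional

lemma IsAxSymSliceDomain.mem_sliceDomain_iff {Ω : Set ℍ} (hΩ : IsAxSymSliceDomain Ω) {z : ℂ}
    {J : ℍ} (hJ : J ∈ imagUnits) :
    z ∈ sliceDomain Ω ↔ (z.re : ℍ) + z.im • J ∈ Ω := by
  change (z : ℍ) ∈ Ω ↔ _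
  rw [coeComplex_eq]
  exact ⟨hΩ.axially_symmetric _ _ _ e1_mem_imagUnits _ hJ,
    hΩ.axially_symmetric _ _ _ hJ _ e1_mem_imagUnits⟩

lemma IsAxSymSliceDomain.conj_mem_sliceDomain {Ω : Set ℍ} (hΩ : IsAxSymSliceDomain Ω) {z : ℂ}
    (hz : z ∈ sliceDomain Ω) :
    (starRingEnd ℂ) z ∈ sliceDomain Ω := by
  rw [hΩ.mem_sliceDomain_iff e1_mem_imagUnits]
  rw [hΩ.mem_sliceDomain_iff (neg_mem_imagUnits e1_mem_imagUnits)] at hz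
  simpa using hz

lemma IsAxSymSliceDomain.sliceCoord_mem {Ω : Set ℍ} (hΩ : IsAxSymSliceDomain Ω) {q : ℍ}
    (hq : q ∈ Ω) : sliceCoord q ∈ sliceDomain Ω := by
  obtain ⟨J, hJ, h⟩ := exists_imagUnit_eq q
  rw [hΩ.mem_sliceDomain_iff hJ, ← h]
  exact hq

/-- Functions `w` with `w (conj z) = conj (w z)` on `U`. -/
def IsIntrinsicOn (U : Set ℂ) (w : ℂ → ℂ) : Prop :=
  ∀ z ∈ U, w ((starRingEnd ℂ) z) = (starRingEnd ℂ) (w z)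

/-- For intrinsic `w` the restriction `0 ≤ y` in the description of `sliceExt w` is not needed: the
value of `w` at `conj z` is what replacing `(y, J)` by `(-y, -J)` requires, and `w` is real at real
points. -/
lemma sliceExt_add_smul {Ω : Set ℍ} {w : ℂ → ℂ} (hw : IsIntrinsicOn (sliceDomain Ω) w) {z : ℂ}
    (hz : z ∈ sliceDomain Ω) {J : ℍ} (hJ : J ∈ imagUnits) :
    sliceExt w ((z.re : ℍ) + z.im • J) = ((w z).re : ℍ) + (w z).im • J := by
  have hn : ‖((z.re : ℍ) + z.im • J).im‖ = |z.im| :=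
    congrArg Complex.im (sliceCoord_add_smul z.re z.im hJ)
  rw [sliceExt, hn, sliceCoord_add_smul _ _ hJ, im_add_smul _ _ hJ, smul_smul]
  rcases lt_trichotomy z.im 0 with h | h | h
  · have : (⟨z.re, |z.im|⟩ : ℂ) = (starRingEnd ℂ) z := by
      rw [abs_of_neg h]; rfl
    rw [this, hw z hz, abs_of_neg h, conj_re, conj_im]
    congr 2
    rw [neg_mul, inv_neg, mul_neg, neg_mul, neg_mul, neg_neg, inv_mul_cancel_right₀ h.ne]
  · have hzc : (starRingEnd ℂ) z = z := conj_eq_iff_im.2 h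
    have h0 : (w z).im = 0 := by
      rw [← conj_eq_iff_im, ← hw z hz, hzc]
    have : (⟨z.re, |z.im|⟩ : ℂ) = z := by
      rw [h, abs_zero, ← h]
    rw [this, h0, zero_mul, zero_mul]
  · have : (⟨z.re, |z.im|⟩ : ℂ) = z := by
      rw [abs_of_pos h]
    rw [this, abs_of_pos h, mul_assoc, inv_mul_cancel₀ h.ne', mul_one]

/-- At a real point an intrinsic holomorphic function is the sum of a power series with real
coefficients, and its slice extension is the sum of the same series in the quaternionic variable. -/
lemma analyticAt_sliceExt_of_real {Ω : Set ℍ} (hΩ : IsAxSymSliceDomain Ω) {w : ℂ → ℂ}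
    (hw : DifferentiableOn ℂ w (sliceDomain Ω)) (hi : IsIntrinsicOn (sliceDomain Ω) w) {x : ℝ}
    (hx : (x : ℍ) ∈ Ω) : AnalyticAt ℝ (sliceExt w) (x : ℍ) := by
  have hD := isOpen_sliceDomain hΩ.isOpen
  have hxD : (x : ℂ) ∈ sliceDomain Ω := by simpa [sliceDomain] using hx
  obtain ⟨p, r₁, hp₁⟩ := hw.analyticAt (hD.mem_nhds hxD)
  obtain ⟨r₂, hr₂, hsub⟩ := EMetric.mem_nhds_iff.1 (hD.mem_nhds hxD)
  obtain ⟨r, hp, hball⟩ : ∃ r, HasFPowerSeriesOnBall w p x r ∧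
      Metric.eball (x : ℂ) r ⊆ sliceDomain Ω :=
    ⟨min r₁ r₂, hp₁.mono (lt_min hp₁.r_pos hr₂) (min_le_left _ _),
      (Metric.eball_subset_eball (min_le_right _ _)).trans hsub⟩
  set a : ℕ → ℝ := fun n => (p.coeff n).re with ha
  refine ⟨FormalMultilinearSeries.ofScalars ℍ a, r, ?_, hp.r_pos, fun {y} hy => ?_⟩
  · refine hp.r_le.trans (FormalMultilinearSeries.radius_le_of_le fun n => ?_)
    rw [FormalMultilinearSeries.ofScalars_norm, FormalMultilinearSeries.norm_apply_eq_norm_coef]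
    exact abs_re_le_norm _
  obtain ⟨J, hJ, hq⟩ := exists_imagUnit_eq (x + y)
  set z := sliceCoord (x + y) with hz
  set φ : ℂ →ₐ[ℝ] ℍ := liftAux J (mul_self_of_mem_imagUnits hJ) with hφ
  have hφa (u : ℂ) : φ u = (u.re : ℍ) + u.im • J := liftAux_apply _ _ u
  -- `φ` sends the power series in `z - x` to the power series in `y`.
  have hy' : φ (z - x) = y := by
    rw [map_sub, hφa, ← hq, hφa]
    simp
  have hnorm : ‖z - x‖ = ‖y‖ := by
    rw [← sq_eq_sq₀ (norm_nonneg _) (norm_nonneg _), ← hy', hφa, ← normSq_eq_norm_sq,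
      sq ‖_‖, ← Quaternion.normSq_eq_norm_mul_self, Quaternion.normSq_def', normSq_apply]
    obtain ⟨h0, h1⟩ := mem_imagUnits_iff.1 hJ
    simp [h0]
    linear_combination (-z.im ^ 2) * h1
  have hzb : z ∈ Metric.eball (x : ℂ) r := by
    rw [Metric.mem_eball, edist_eq_enorm_sub, ← ofReal_norm, hnorm]
    simpa using hy
  have hzD := hball hzb
  have hzcb : (starRingEnd ℂ) z ∈ Metric.eball (x : ℂ) r := by
    rw [Metric.mem_eball, edist_eq_enorm_sub, ← ofReal_norm] at hzb ⊢
    rwa [← norm_conj, map_sub, conj_conj, conj_ofReal]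
  have hs₁ : HasSum (fun n => (z - x) ^ n * p.coeff n) (w z) := by
    simpa only [FormalMultilinearSeries.apply_eq_pow_smul_coeff, smul_eq_mul] using
      hp.hasSum_sub hzb
  -- Conjugating the series at `conj z` gives a second one for `w z`; the average of the two has
  -- real coefficients.
  have hs₂ : HasSum (fun n => (z - x) ^ n * (starRingEnd ℂ) (p.coeff n)) (w z) := by
    have := hp.hasSum_sub hzcb
    simp only [FormalMultilinearSeries.apply_eq_pow_smul_coeff, smul_eq_mul, hi z hzD] at this
    simpa using (hasSum_conj'.2 this)
  have hs : HasSum (fun n => (z - x) ^ n * (a n : ℂ)) (w z) := by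
    have := (hs₁.add hs₂).mul_left (1 / 2 : ℂ)
    rw [show (1 / 2 : ℂ) * (w z + w z) = w z by ring] at this
    have hfun : (fun n => (z - x) ^ n * (a n : ℂ)) = fun n => (1 / 2 : ℂ) *
        ((z - x) ^ n * p.coeff n + (z - x) ^ n * (starRingEnd ℂ) (p.coeff n)) := by
      funext n
      rw [ha, re_eq_add_conj]
      ring
    rwa [hfun]
  have hφs := hs.map φ φ.toLinearMap.continuous_of_finiteDimensional
  rw [hφa (w z), ← sliceExt_add_smul hi hzD hJ, ← hq] at hφs
  have hfun : (fun n => FormalMultilinearSeries.ofScalars ℍ a n fun _ => y) =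
      φ ∘ fun n => (z - x) ^ n * (a n : ℂ) := by
    funext n
    simp [FormalMultilinearSeries.ofScalars_apply_eq, hy', hφa (a n : ℂ),
      Quaternion.mul_coe_eq_smul]
  rwa [hfun]

lemma eq_coe_re_of_im_eq_zero {q : ℍ} (hq : q.im = 0) : q = (q.re : ℍ) := by
  conv_lhs => rw [← Quaternion.re_add_im q, hq, add_zero]

lemma contDiffOn_sliceExt {Ω : Set ℍ} (hΩ : IsAxSymSliceDomain Ω) {w : ℂ → ℂ}
    (hw : DifferentiableOn ℂ w (sliceDomain Ω)) (hi : IsIntrinsicOn (sliceDomain Ω) w) :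
    ContDiffOn ℝ ∞ (sliceExt w) Ω := fun q hq => by
  refine ContDiffAt.contDiffWithinAt ?_
  by_cases h : q.im = 0
  · rw [eq_coe_re_of_im_eq_zero h] at hq ⊢
    exact (analyticAt_sliceExt_of_real hΩ hw hi hq).contDiffAt
  · exact contDiffAt_sliceExt_of_im_ne_zero
      (hw.analyticAt ((isOpen_sliceDomain hΩ.isOpen).mem_nhds (hΩ.sliceCoord_mem hq))) h

/-! ### Slice functions -/

lemma mem_realAxis_iff {q : ℍ} : q ∈ realAxis ↔ q.im = 0 :=
  ⟨by rintro ⟨x, rfl⟩; simp, fun h => ⟨q.re, (eq_coe_re_of_im_eq_zero h).symm⟩⟩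

/-- Every real point is a limit of the non-real points `q + t i`, `t → 0`, so that the extension by
limits in `globalV` is determined. -/
lemma subset_closure_diff_realAxis {Ω : Set ℍ} (hΩ : IsOpen Ω) : Ω ⊆ closure (Ω \ realAxis) := by
  refine Dense.open_subset_closure_inter (s := realAxisᶜ) (fun q => ?_) hΩ
  by_cases hq : q ∈ realAxis
  · have ht : Tendsto (fun t : ℝ => q + t • e1) (𝓝[≠] 0) (𝓝 q) := by
      have : Continuous fun t : ℝ => q + t • e1 := by fun_prop
      simpa using (this.tendsto 0).mono_left nhdsWithin_le_nhds
    refine mem_closure_of_tendsto ht ?_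
    filter_upwards [self_mem_nhdsWithin] with t ht
    intro h
    have h1 := congrArg QuaternionAlgebra.imI (mem_realAxis_iff.1 h)
    have h2 := congrArg QuaternionAlgebra.imI (mem_realAxis_iff.1 hq)
    simp at h1 h2
    rw [h2, zero_add] at h1
    exact ht h1
  · exact subset_closure hq

section SliceFunction

variable {Ω : Set ℍ}

lemma IsSliceFunctionOn.mul_const {f : ℍ → ℍ} (hf : IsSliceFunctionOn Ω f) (c : ℍ) :
    IsSliceFunctionOn Ω fun q => f q * c := by
  obtain ⟨α, β, h⟩ := hf
  refine ⟨fun x y => α x y * c, fun x y => β x y * c, fun x y J hJ hq => ?_⟩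
  obtain ⟨h1, h2, h3⟩ := h x y J hJ hq
  simp only [h1, h2, h3]
  exact ⟨trivial, by rw [neg_mul], by rw [add_mul, mul_assoc]⟩

lemma IsSliceFunctionOn.finsetSum {ι : Type*} {s : Finset ι} {f : ι → ℍ → ℍ}
    (hf : ∀ i, IsSliceFunctionOn Ω (f i)) : IsSliceFunctionOn Ω fun q => ∑ i ∈ s, f i q := by
  choose α β h using hf
  refine ⟨fun x y => ∑ i ∈ s, α i x y, fun x y => ∑ i ∈ s, β i x y, fun x y J hJ hq => ?_⟩
  simp only [fun i => (h i x y J hJ hq).1, fun i => (h i x y J hJ hq).2.1,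
    fun i => (h i x y J hJ hq).2.2, Finset.sum_neg_distrib, Finset.sum_add_distrib, Finset.mul_sum]
  simp

lemma IsSliceFunctionOn.re_pow_smul {f : ℍ → ℍ} (hf : IsSliceFunctionOn Ω f) (k : ℕ) :
    IsSliceFunctionOn Ω fun q => q.re ^ k • f q := by
  obtain ⟨α, β, h⟩ := hf
  refine ⟨fun x y => x ^ k • α x y, fun x y => x ^ k • β x y, fun x y J hJ hq => ?_⟩
  obtain ⟨h1, h2, h3⟩ := h x y J hJ hq
  have hre : ((x : ℍ) + y • J).re = x := by simp [(mem_imagUnits_iff.1 hJ).1]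
  simp only [h1, h2, h3, hre]
  exact ⟨trivial, by rw [smul_neg], by rw [smul_add, mul_smul_comm]⟩

lemma isSliceFunctionOn_sliceExt (w : ℂ → ℂ) : IsSliceFunctionOn Ω (sliceExt w) := by
  refine ⟨fun x y => ((w ⟨x, |y|⟩).re : ℍ), fun x y => (((w ⟨x, |y|⟩).im * |y|⁻¹ * y : ℝ) : ℍ),
    fun x y J hJ hq => ⟨by simp, by simp, ?_⟩⟩
  have hn : ‖((x : ℍ) + y • J).im‖ = |y| := congrArg Complex.im (sliceCoord_add_smul x y hJ)
  rw [sliceExt, hn, sliceCoord_add_smul _ _ hJ, im_add_smul _ _ hJ, smul_smul,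
    Quaternion.mul_coe_eq_smul]

/-- Identity principle for slice functions: the values on one slice determine the function. -/
lemma IsSliceFunctionOn.eqOn (hΩ : IsAxSymSliceDomain Ω) {f g : ℍ → ℍ}
    (hf : IsSliceFunctionOn Ω f) (hg : IsSliceFunctionOn Ω g)
    (h : ∀ z ∈ sliceDomain Ω, f z = g z) : Set.EqOn f g Ω := by
  intro q hq
  obtain ⟨J, hJ, hqJ⟩ := exists_imagUnit_eq q
  have hz := hΩ.sliceCoord_mem hq
  set z := sliceCoord q
  obtain ⟨α, β, h₁⟩ := hf
  obtain ⟨α', β', h₂⟩ := hg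
  have mem {z : ℂ} (hz : z ∈ sliceDomain Ω) := (hΩ.mem_sliceDomain_iff e1_mem_imagUnits).1 hz
  have hzc := hΩ.conj_mem_sliceDomain hz
  have k₁ := h z hz
  have k₂ := h _ hzc
  obtain ⟨p₁, p₂, p₃⟩ := h₁ _ _ e1 e1_mem_imagUnits (mem hz)
  obtain ⟨r₁, r₂, r₃⟩ := h₂ _ _ e1 e1_mem_imagUnits (mem hz)
  have p₄ := (h₁ _ _ e1 e1_mem_imagUnits (mem hzc)).2.2
  have r₄ := (h₂ _ _ e1 e1_mem_imagUnits (mem hzc)).2.2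
  rw [coeComplex_eq, p₃, r₃] at k₁
  rw [coeComplex_eq, p₄, r₄, conj_re, conj_im, p₁, p₂, r₁, r₂, mul_neg,
    mul_neg] at k₂
  have hα : α z.re z.im = α' z.re z.im := by
    have : (2 : ℝ) • α z.re z.im = (2 : ℝ) • α' z.re z.im := by
      calc (2 : ℝ) • α z.re z.im
          = (α z.re z.im + e1 * β z.re z.im) + (α z.re z.im + -(e1 * β z.re z.im)) := by module
        _ = (2 : ℝ) • α' z.re z.im := by rw [k₁, k₂]; module
    exact smul_right_injective ℍ (two_ne_zero' ℝ) this
  have hβ : β z.re z.im = β' z.re z.im := by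
    rw [hα] at k₁
    have := congrArg (e1 * ·) (add_left_cancel k₁)
    simpa [← mul_assoc, mul_self_of_mem_imagUnits e1_mem_imagUnits] using this
  rw [hqJ, (h₁ _ _ J hJ (hqJ ▸ hq)).2.2, (h₂ _ _ J hJ (hqJ ▸ hq)).2.2, hα, hβ]

end SliceFunction

/-! ### Rules for the operators -/

section Operators

variable {ι : Type*} {s : Finset ι} {q : ℍ}

lemma cauchyFueter_finsetSum {f : ι → ℍ → ℍ} (hf : ∀ i, DifferentiableAt ℝ (f i) q) :
    cauchyFueter (fun p => ∑ i ∈ s, f i p) q = ∑ i ∈ s, cauchyFueter (f i) q := by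
  simp only [cauchyFueter_eq_sum, lineDeriv_finsetSum fun i _ => hf i, Finset.mul_sum]
  rw [Finset.sum_comm]

lemma laplacian_finsetSum {f : ι → ℍ → ℍ} (hf : ∀ i, ContDiffAt ℝ 2 (f i) q) :
    Laplacian.laplacian (fun p => ∑ i ∈ s, f i p) q = ∑ i ∈ s, Laplacian.laplacian (f i) q := by
  classical
  induction s using Finset.induction_on with
  | empty => simp [InnerProductSpace.laplacian_const]
  | insert a s ha ih =>
    rw [Finset.sum_insert ha, ← ih, ← (hf a).laplacian_add (ContDiffAt.sum fun i _ => hf i)]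
    refine congrFun (congrArg _ (funext fun p => ?_)) q
    simp [Finset.sum_insert ha]

lemma rawV_finsetSum {f : ι → ℍ → ℍ} (hf : ∀ i, DifferentiableAt ℝ (f i) q) :
    rawV (fun p => ∑ i ∈ s, f i p) q = ∑ i ∈ s, rawV (f i) q := by
  simp only [rawV, pd0, pd1, pd2, pd3, lineDeriv_finsetSum fun i _ => hf i, Finset.smul_sum,
    Finset.sum_add_distrib, Finset.mul_sum, mul_add, smul_add]

lemma lineDeriv_mul_const {f : ℍ → ℍ} (hf : DifferentiableAt ℝ f q) (c v : ℍ) :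
    lineDeriv ℝ (fun p => f p * c) q v = lineDeriv ℝ f q v * c :=
  lineDeriv_clm_comp ((ContinuousLinearMap.mul ℝ ℍ).flip c) hf v

lemma rawV_mul_const {f : ℍ → ℍ} (hf : DifferentiableAt ℝ f q) (c : ℍ) :
    rawV (fun p => f p * c) q = rawV f q * c := by
  simp only [rawV, pd0, pd1, pd2, pd3, lineDeriv_mul_const hf, add_mul, smul_mul_assoc, mul_assoc]

lemma cauchyFueter_mul_const {f : ℍ → ℍ} (hf : DifferentiableAt ℝ f q) (c : ℍ) :
    cauchyFueter (fun p => f p * c) q = cauchyFueter f q * c := by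
  simp only [cauchyFueter, pd0, pd1, pd2, pd3, lineDeriv_mul_const hf, add_mul, mul_assoc]

lemma laplacian_mul_const {f : ℍ → ℍ} (hf : ContDiffAt ℝ 2 f q) (c : ℍ) :
    Laplacian.laplacian (fun p => f p * c) q = Laplacian.laplacian f q * c :=
  hf.laplacian_CLM_comp_left (l := (ContinuousLinearMap.mul ℝ ℍ).flip c)

/-- The operator `V` is a derivation on products with functions of `x₀` alone. -/
lemma rawV_re_pow_smul {f : ℍ → ℍ} (hf : DifferentiableAt ℝ f q) (c : ℝ) (k : ℕ) :
    rawV (fun p => (c * p.re ^ k) • f p) q =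
      (c * (k * q.re ^ (k - 1))) • f q + (c * q.re ^ k) • rawV f q := by
  have key (v : ℍ) : lineDeriv ℝ (fun p => (c * p.re ^ k) • f p) q v =
      (c * q.re ^ k) • lineDeriv ℝ f q v + (c * (k * q.re ^ (k - 1) * v.re)) • f q := by
    have hr : HasDerivAt (fun t : ℝ => (q + t • v).re) v.re 0 :=
      quatReCLM.hasFDerivAt.hasLineDerivAt v
    have h : HasDerivAt (fun t : ℝ => f (q + t • v)) _ 0 :=
      hf.lineDifferentiableAt.hasLineDerivAt
    have := ((hr.fun_pow k).const_mul c).fun_smul h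
    simp only [zero_smul, add_zero] at this
    exact this.deriv
  simp only [rawV, pd0, pd1, pd2, pd3, key, e1_re, e2_re, e3_re, mul_zero, zero_smul, add_zero,
    Quaternion.re_one, mul_one, smul_add, mul_add, mul_smul_comm]
  simp only [smul_smul]
  module

lemma rawV_congr {f g : ℍ → ℍ} (h : f =ᶠ[𝓝 q] g) : rawV f q = rawV g q := by
  simp only [rawV, pd0, pd1, pd2, pd3, h.lineDeriv_eq]

lemma cauchyFueter_congr {f g : ℍ → ℍ} (h : f =ᶠ[𝓝 q] g) : cauchyFueter f q = cauchyFueter g q := by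
  simp only [cauchyFueter, pd0, pd1, pd2, pd3, h.lineDeriv_eq]

end Operators

/-! ### Smooth slice functions in the kernel of `V` -/

/-- Smooth slice functions on `Ω` which off the real axis are annihilated by `V` and mapped by the
Laplacian to the kernel of the Cauchy-Fueter operator. This class contains the slice extensions of
holomorphic functions and is closed under sums and multiplication by constants from the right. -/
structure IsRegularSlice (Ω : Set ℍ) (h : ℍ → ℍ) : Prop where
  contDiffOn : ContDiffOn ℝ ∞ h Ω
  slice : IsSliceFunctionOn Ω h
  rawV_eq_zero : ∀ q ∈ Ω \ realAxis, rawV h q = 0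
  cauchyFueter_laplacian_eq_zero :
    ∀ q ∈ Ω \ realAxis, cauchyFueter (Laplacian.laplacian h) q = 0

section RegularSlice

variable {Ω : Set ℍ}

lemma IsRegularSlice.contDiffAt (hΩ : IsOpen Ω) {h : ℍ → ℍ} (hh : IsRegularSlice Ω h) {q : ℍ}
    (hq : q ∈ Ω) (n : ℕ) : ContDiffAt ℝ n h q :=
  (hh.contDiffOn.contDiffAt (hΩ.mem_nhds hq)).of_le (by exact_mod_cast le_top)

lemma IsRegularSlice.differentiableAt (hΩ : IsOpen Ω) {h : ℍ → ℍ} (hh : IsRegularSlice Ω h)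
    {q : ℍ} (hq : q ∈ Ω) : DifferentiableAt ℝ h q :=
  (hh.contDiffAt hΩ hq 1).differentiableAt (by simp)

lemma IsRegularSlice.differentiableAt_laplacian (hΩ : IsOpen Ω) {h : ℍ → ℍ}
    (hh : IsRegularSlice Ω h) {q : ℍ} (hq : q ∈ Ω) :
    DifferentiableAt ℝ (Laplacian.laplacian h) q :=
  (contDiffAt_laplacian (n := 1) (hh.contDiffAt hΩ hq 3)).differentiableAt (by simp)

lemma isRegularSlice_sliceExt (hΩ : IsAxSymSliceDomain Ω) {w : ℂ → ℂ}
    (hw : DifferentiableOn ℂ w (sliceDomain Ω)) (hi : IsIntrinsicOn (sliceDomain Ω) w) :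
    IsRegularSlice Ω (sliceExt w) where
  contDiffOn := contDiffOn_sliceExt hΩ hw hi
  slice := isSliceFunctionOn_sliceExt w
  rawV_eq_zero _ hq := rawV_sliceExt (hw.differentiableAt
    ((isOpen_sliceDomain hΩ.isOpen).mem_nhds (hΩ.sliceCoord_mem hq.1)))
    (mem_realAxis_iff.not.1 hq.2)
  cauchyFueter_laplacian_eq_zero _ hq := cauchyFueter_laplacian_sliceExt (hw.analyticAt
    ((isOpen_sliceDomain hΩ.isOpen).mem_nhds (hΩ.sliceCoord_mem hq.1)))
    (mem_realAxis_iff.not.1 hq.2)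

lemma IsRegularSlice.mul_const (hΩ : IsOpen Ω) {h : ℍ → ℍ} (hh : IsRegularSlice Ω h) (c : ℍ) :
    IsRegularSlice Ω fun q => h q * c where
  contDiffOn := hh.contDiffOn.mul contDiffOn_const
  slice := hh.slice.mul_const c
  rawV_eq_zero q hq := by
    rw [rawV_mul_const (hh.differentiableAt hΩ hq.1), hh.rawV_eq_zero q hq, zero_mul]
  cauchyFueter_laplacian_eq_zero q hq := by
    have hev : Laplacian.laplacian (fun p => h p * c) =ᶠ[𝓝 q]
        fun p => Laplacian.laplacian h p * c := by
      filter_upwards [hΩ.mem_nhds hq.1] with p hp using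
        laplacian_mul_const (hh.contDiffAt hΩ hp 2) c
    rw [cauchyFueter_congr hev, cauchyFueter_mul_const (hh.differentiableAt_laplacian hΩ hq.1),
      hh.cauchyFueter_laplacian_eq_zero q hq, zero_mul]

lemma IsRegularSlice.finsetSum (hΩ : IsOpen Ω) {ι : Type*} {s : Finset ι} {h : ι → ℍ → ℍ}
    (hh : ∀ i, IsRegularSlice Ω (h i)) : IsRegularSlice Ω fun q => ∑ i ∈ s, h i q where
  contDiffOn := ContDiffOn.sum fun i _ => (hh i).contDiffOn
  slice := IsSliceFunctionOn.finsetSum fun i => (hh i).slice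
  rawV_eq_zero q hq := by
    rw [rawV_finsetSum fun i => (hh i).differentiableAt hΩ hq.1]
    exact Finset.sum_eq_zero fun i _ => (hh i).rawV_eq_zero q hq
  cauchyFueter_laplacian_eq_zero q hq := by
    have hev : Laplacian.laplacian (fun p => ∑ i ∈ s, h i p) =ᶠ[𝓝 q]
        fun p => ∑ i ∈ s, Laplacian.laplacian (h i) p := by
      filter_upwards [hΩ.mem_nhds hq.1] with p hp using
        laplacian_finsetSum fun i => (hh i).contDiffAt hΩ hp 2
    rw [cauchyFueter_congr hev,
      cauchyFueter_finsetSum fun i => (hh i).differentiableAt_laplacian hΩ hq.1]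
    exact Finset.sum_eq_zero fun i _ => (hh i).cauchyFueter_laplacian_eq_zero q hq

/-- Fueter's theorem on all of `Ω`. The equation extends to the real points by continuity. -/
lemma IsRegularSlice.isFueterRegularOn_laplacian (hΩ : IsOpen Ω) {h : ℍ → ℍ}
    (hh : IsRegularSlice Ω h) : IsFueterRegularOn (Laplacian.laplacian h) Ω := by
  refine ⟨fun q hq => (contDiffAt_laplacian (n := 1)
    (hh.contDiffAt hΩ hq 3)).contDiffWithinAt, ?_⟩
  refine Set.EqOn.of_subset_closure (s := Ω \ realAxis) (g := fun _ => 0)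
    hh.cauchyFueter_laplacian_eq_zero (fun q hq => ?_) continuousOn_const Set.sdiff_subset
    (subset_closure_diff_realAxis hΩ)
  exact (contDiffAt_cauchyFueter (n := 0) (contDiffAt_laplacian (n := 1)
    (hh.contDiffAt hΩ hq 3))).continuousAt.continuousWithinAt

end RegularSlice

/-! ### Almansi decomposition of slice polyanalytic functions -/

lemma contDiffOn_dbar {Ω : Set ℍ} (hΩ : IsOpen Ω) {f : ℍ → ℍ} {n : ℕ} (J : ℍ)
    (hf : ContDiffOn ℝ (n + 1) f Ω) : ContDiffOn ℝ n (dbar J f) Ω := fun q hq => by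
  have h := hf.contDiffAt (hΩ.mem_nhds hq)
  exact (((contDiffAt_lineDeriv h 1).add
    (contDiffAt_const.mul (contDiffAt_lineDeriv h J))).const_smul _).contDiffWithinAt

lemma contDiffOn_iterate_dbar {Ω : Set ℍ} (hΩ : IsOpen Ω) {f : ℍ → ℍ} {n m : ℕ} (J : ℍ)
    (hf : ContDiffOn ℝ (n + m : ℕ) f Ω) : ContDiffOn ℝ n ((dbar J)^[m] f) Ω := by
  induction m generalizing f with
  | zero => simpa using hf
  | succ m ih => exact ih (contDiffOn_dbar hΩ J (by exact_mod_cast hf))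

/-- A left `ℂ`-linear coordinate on `ℍ` intertwines the slice Cauchy-Riemann operator of the slice
`ℂ_i` with the Wirtinger operator. -/
lemma iterate_wirtinger_comp {Ω : Set ℍ} (hΩ : IsOpen Ω) (P : ℍ →L[ℝ] ℂ)
    (hP : ∀ q, P (e1 * q) = I * P q) {f : ℍ → ℍ} {m : ℕ} (hf : ContDiffOn ℝ m f Ω) :
    Set.EqOn (wirtinger^[m] fun z => P (f z)) (fun z => P ((dbar e1)^[m] f z)) (sliceDomain Ω) := by
  induction m with
  | zero => exact fun z _ => rfl
  | succ m ih =>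
    intro z hz
    set g := (dbar e1)^[m] f with hg
    have hd : DifferentiableAt ℝ g z :=
      ((contDiffOn_iterate_dbar hΩ e1 (n := 1) (by rwa [add_comm])).contDiffAt
        (hΩ.mem_nhds hz)).differentiableAt (by simp)
    have key (v : ℂ) : lineDeriv ℝ (fun z : ℂ => P (g z)) z v = P (lineDeriv ℝ g z (v : ℍ)) := by
      rw [← lineDeriv_clm_comp P hd]
      have (t : ℝ) : ((z + t • v : ℂ) : ℍ) = (z : ℍ) + t • (v : ℍ) := by ext <;> simp
      simp only [lineDeriv, this]
    have hI : ((I : ℂ) : ℍ) = e1 := by ext <;> simp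
    change _ = P ((dbar e1)^[m + 1] f z)
    rw [Function.iterate_succ_apply', wirtinger_congr ((ih (hf.of_le (by
      norm_cast; omega))).eventuallyEq_of_mem ((isOpen_sliceDomain hΩ).mem_nhds hz)),
      Function.iterate_succ_apply', wirtinger, dbar, key, key, map_smul, map_add, hP, hI,
      Quaternion.coeComplex_one]

/-- The coordinate `u` in `q = u + v j` with `u, v ∈ ℂ`. -/
def complexFst : ℍ →L[ℝ] ℂ :=
  LinearMap.toContinuousLinearMap
    { toFun := fun q => ⟨q.re, q.imI⟩
      map_add' := fun _ _ => by apply Complex.ext <;> simp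
      map_smul' := fun _ _ => by apply Complex.ext <;> simp }

/-- The coordinate `v` in `q = u + v j` with `u, v ∈ ℂ`. -/
def complexSnd : ℍ →L[ℝ] ℂ :=
  LinearMap.toContinuousLinearMap
    { toFun := fun q => ⟨q.imJ, q.imK⟩
      map_add' := fun _ _ => by apply Complex.ext <;> simp
      map_smul' := fun _ _ => by apply Complex.ext <;> simp }

lemma complexFst_apply (q : ℍ) : complexFst q = ⟨q.re, q.imI⟩ := rfl
lemma complexSnd_apply (q : ℍ) : complexSnd q = ⟨q.imJ, q.imK⟩ := rfl

lemma complexFst_e1_mul (q : ℍ) : complexFst (e1 * q) = I * complexFst q := by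
  apply Complex.ext <;> simp [complexFst_apply]

lemma complexSnd_e1_mul (q : ℍ) : complexSnd (e1 * q) = I * complexSnd q := by
  apply Complex.ext <;> simp [complexSnd_apply]

lemma complexFst_add_complexSnd_mul (q : ℍ) :
    (complexFst q : ℍ) + (complexSnd q : ℍ) * e2 = q := by
  ext <;> simp [complexFst_apply, complexSnd_apply]

/-- On a domain symmetric about the real axis, a holomorphic function is `a + b i` with `a` and `b`
holomorphic and intrinsic. -/
lemma exists_intrinsic_decomposition {Ω : Set ℍ} (hΩ : IsAxSymSliceDomain Ω) {u : ℂ → ℂ}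
    (hu : DifferentiableOn ℂ u (sliceDomain Ω)) :
    ∃ a b : ℂ → ℂ, DifferentiableOn ℂ a (sliceDomain Ω) ∧ IsIntrinsicOn (sliceDomain Ω) a ∧
      DifferentiableOn ℂ b (sliceDomain Ω) ∧ IsIntrinsicOn (sliceDomain Ω) b ∧
      ∀ z, u z = a z + b z * I := by
  have hD := isOpen_sliceDomain hΩ.isOpen
  set u' : ℂ → ℂ := fun z => (starRingEnd ℂ) (u ((starRingEnd ℂ) z)) with hu'
  have hd : DifferentiableOn ℂ u' (sliceDomain Ω) := fun z hz => by
    have := (hu.differentiableAt (hD.mem_nhds (hΩ.conj_mem_sliceDomain hz))).conj_conj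
    rw [conj_conj] at this
    exact this.differentiableWithinAt
  refine ⟨fun z => (1 / 2) * (u z + u' z), fun z => (-I / 2) * (u z - u' z),
    (hu.add hd).const_mul _, fun z _ => ?_, (hu.sub hd).const_mul _, fun z _ => ?_, fun z => ?_⟩
  · simp [hu', conj_ofNat]
    ring
  · simp [hu', conj_ofNat]
    ring
  · linear_combination (1 / 2 * (u z - u' z)) * I_mul_I

/-- The slice extensions of holomorphic functions with values in `ℍ = ℂ ⊕ ℂ j`. -/
lemma exists_isRegularSlice_extension {Ω : Set ℍ} (hΩ : IsAxSymSliceDomain Ω) {u v : ℂ → ℂ}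
    (hu : DifferentiableOn ℂ u (sliceDomain Ω)) (hv : DifferentiableOn ℂ v (sliceDomain Ω)) :
    ∃ h, IsRegularSlice Ω h ∧ ∀ z ∈ sliceDomain Ω, h z = (u z : ℍ) + (v z : ℍ) * e2 := by
  obtain ⟨a, b, ha, hia, hb, hib, hab⟩ := exists_intrinsic_decomposition hΩ hu
  obtain ⟨c, d, hc, hic, hd, hid, hcd⟩ := exists_intrinsic_decomposition hΩ hv
  have hw (i : Fin 4) : IsRegularSlice Ω (sliceExt (![a, b, c, d] i)) := by
    fin_cases i
    exacts [isRegularSlice_sliceExt hΩ ha hia, isRegularSlice_sliceExt hΩ hb hib,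
      isRegularSlice_sliceExt hΩ hc hic, isRegularSlice_sliceExt hΩ hd hid]
  have hval {w : ℂ → ℂ} (hw : IsIntrinsicOn (sliceDomain Ω) w) {z : ℂ} (hz : z ∈ sliceDomain Ω) :
      sliceExt w z = (w z : ℍ) := by
    rw [coeComplex_eq z, sliceExt_add_smul hw hz e1_mem_imagUnits, ← coeComplex_eq]
  have hI : ((I : ℂ) : ℍ) = e1 := by ext <;> simp
  refine ⟨_, IsRegularSlice.finsetSum hΩ.isOpen (s := Finset.univ) fun i =>
    (hw i).mul_const hΩ.isOpen (![1, e1, e2, e1 * e2] i), fun z hz => ?_⟩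
  simp only [Fin.sum_univ_four, hab, hcd]
  simp [hval hia hz, hval hib hz, hval hic hz, hval hid hz, hI, add_mul, mul_assoc, add_assoc]

/-- Almansi decomposition: a slice polyanalytic function of order `n` is a polynomial in `x₀` of
degree less than `n` whose coefficients are slice regular. -/
lemma IsSlicePolyanalyticOn.exists_decomposition {Ω : Set ℍ} (hΩ : IsAxSymSliceDomain Ω) {n : ℕ}
    {f : ℍ → ℍ} (hf : IsSlicePolyanalyticOn n Ω f) :
    ∃ h : ℕ → ℍ → ℍ, (∀ k, IsRegularSlice Ω (h k)) ∧
      Set.EqOn f (fun q => ∑ k ∈ Finset.range n, q.re ^ k • h k q) Ω := by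
  have hD := isOpen_sliceDomain hΩ.isOpen
  have hcoe : ContDiff ℝ n (fun z : ℂ => (z : ℍ)) :=
    Quaternion.ofComplex.toLinearMap.toContinuousLinearMap.contDiff
  have hplane {z : ℂ} (hz : z ∈ sliceDomain Ω) : (z : ℍ) ∈ Ω ∩ slicePlane e1 :=
    ⟨hz, z.re, z.im, coeComplex_eq z⟩
  have main (P : ℍ →L[ℝ] ℂ) (hP : ∀ q, P (e1 * q) = I * P q) :=
    exists_holomorphic_decomposition hD (n := n) (u := fun z => P (f z))
      (P.contDiff.comp_contDiffOn (hf.contDiffOn.comp hcoe.contDiffOn fun _ hz => hz))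
      fun z hz => by
        rw [iterate_wirtinger_comp hΩ.isOpen P hP hf.contDiffOn hz]
        beta_reduce
        rw [hf.dbar_eq_zero e1 e1_mem_imagUnits _ (hplane hz), map_zero]
  obtain ⟨u, hu, hsu⟩ := main complexFst complexFst_e1_mul
  obtain ⟨v, hv, hsv⟩ := main complexSnd complexSnd_e1_mul
  choose h hh hval using fun k => exists_isRegularSlice_extension hΩ (hu k) (hv k)
  refine ⟨h, hh, hf.slice.eqOn hΩ
    (IsSliceFunctionOn.finsetSum fun k => (hh k).slice.re_pow_smul k) fun z hz => ?_⟩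
  have hmap (w : ℕ → ℂ → ℂ) : ((∑ k ∈ Finset.range n, (z.re : ℂ) ^ k * w k z : ℂ) : ℍ) =
      ∑ k ∈ Finset.range n, z.re ^ k • (w k z : ℍ) := by
    rw [← Quaternion.coe_ofComplex, map_sum]
    refine Finset.sum_congr rfl fun k _ => ?_
    rw [← ofReal_pow, ← real_smul, map_smul]
  rw [← complexFst_add_complexSnd_mul (f z), hsu z hz, hsv z hz, hmap, hmap, Finset.sum_mul,
    ← Finset.sum_add_distrib]
  refine Finset.sum_congr rfl fun k _ => ?_
  rw [hval k z hz, smul_add, smul_mul_assoc, Quaternion.re_coeComplex]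

/-! ### Powers of the global operator -/

/-- The function which `V ^ m` makes of `∑ k < n, x₀ ^ k h k`, when `V` annihilates every `h k`. -/
def reDerivSum (n m : ℕ) (h : ℕ → ℍ → ℍ) (q : ℍ) : ℍ :=
  ∑ k ∈ Finset.range n, (k.descFactorial m * q.re ^ (k - m) : ℝ) • h k q

section PowV

variable {Ω : Set ℍ} {n : ℕ} {h : ℕ → ℍ → ℍ}

lemma contDiffOn_reDerivSum (hh : ∀ k, IsRegularSlice Ω (h k)) (m : ℕ) :
    ContDiffOn ℝ ∞ (reDerivSum n m h) Ω :=
  ContDiffOn.sum fun k _ => ((contDiff_const.mul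
    (quatReCLM.contDiff.pow (k - m))).contDiffOn).smul (hh k).contDiffOn

lemma rawV_reDerivSum (hΩ : IsOpen Ω) (hh : ∀ k, IsRegularSlice Ω (h k)) (m : ℕ) :
    Set.EqOn (rawV (reDerivSum n m h)) (reDerivSum n (m + 1) h) (Ω \ realAxis) := by
  intro q hq
  have hd (k : ℕ) := (hh k).differentiableAt hΩ hq.1
  have hre : DifferentiableAt ℝ (fun q : ℍ => q.re) q := quatReCLM.differentiableAt
  have hdk (k : ℕ) : DifferentiableAt ℝ
      (fun q : ℍ => (k.descFactorial m * q.re ^ (k - m) : ℝ) • h k q) q :=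
    ((hre.pow (k - m)).const_mul _).smul (hd k)
  change rawV (fun q => ∑ k ∈ Finset.range n, (k.descFactorial m * q.re ^ (k - m) : ℝ) • h k q) q
    = _
  rw [rawV_finsetSum hdk, reDerivSum]
  refine Finset.sum_congr rfl fun k _ => ?_
  rw [rawV_re_pow_smul (hd k), (hh k).rawV_eq_zero q hq, smul_zero, add_zero,
    Nat.descFactorial_succ, Nat.sub_sub]
  congr 1
  push_cast
  ring

/-- If `rawV f` agrees off the real axis with a function continuous on `Ω`, then that function is
its extension by limits. -/
lemma globalV_eqOn (hΩ : IsOpen Ω) {f g : ℍ → ℍ} (hg : ContinuousOn g Ω)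
    (h : Set.EqOn (rawV f) g (Ω \ realAxis)) : Set.EqOn (globalV Ω f) g Ω := fun q hq => by
  refine extendFrom_eq (subset_closure_diff_realAxis hΩ hq) ?_
  have ht : Tendsto g (𝓝[Ω \ realAxis] q) (𝓝 (g q)) := (hg q hq).mono Set.sdiff_subset
  refine ht.congr' ?_
  filter_upwards [self_mem_nhdsWithin] with p hp using (h hp).symm

lemma rawV_eqOn_of_eqOn (hΩ : IsOpen Ω) {f g : ℍ → ℍ} (h : Set.EqOn f g Ω) :
    Set.EqOn (rawV f) (rawV g) Ω :=
  fun _ hq => rawV_congr (h.eventuallyEq_of_mem (hΩ.mem_nhds hq))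

lemma powV_eqOn (hΩ : IsOpen Ω) (hh : ∀ k, IsRegularSlice Ω (h k)) {f : ℍ → ℍ}
    (hf : Set.EqOn f (reDerivSum n 0 h) Ω) (m : ℕ) :
    Set.EqOn (powV Ω m f) (reDerivSum n m h) Ω := by
  induction m with
  | zero => exact hf
  | succ m ih =>
    rw [powV, Function.iterate_succ_apply']
    exact globalV_eqOn hΩ (contDiffOn_reDerivSum hh _).continuousOn
      (((rawV_eqOn_of_eqOn hΩ ih).mono Set.sdiff_subset).trans (rawV_reDerivSum hΩ hh m))

/-- Only the top coefficient survives the `n`-th step. -/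
lemma isRegularSlice_reDerivSum (hΩ : IsOpen Ω) (hh : ∀ k, IsRegularSlice Ω (h k)) :
    IsRegularSlice Ω (reDerivSum (n + 1) n h) := by
  have : reDerivSum (n + 1) n h = fun q => h n q * ((n.factorial : ℝ) : ℍ) := by
    funext q
    rw [reDerivSum, Finset.sum_range_succ, Finset.sum_eq_zero fun k hk => ?_, zero_add,
      Nat.descFactorial_self, Nat.sub_self, pow_zero, mul_one, Quaternion.mul_coe_eq_smul]
    rw [Nat.descFactorial_eq_zero_iff_lt.2 (Finset.mem_range.1 hk), Nat.cast_zero, zero_mul,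
      zero_smul]
  rw [this]
  exact (hh n).mul_const hΩ _

end PowV

end PolyFueter

end

theorem mainTheorem1 (Ω : Set ℍ) (hΩ : PolyFueter.IsAxSymSliceDomain Ω)
    (n : ℕ) (hn : 1 ≤ n) (f : ℍ → ℍ) (hf : PolyFueter.IsSlicePolyanalyticOn n Ω f) :
    PolyFueter.PowVDefinedOn Ω (n - 1) f ∧
    ContDiffOn ℝ 2 (PolyFueter.powV Ω (n - 1) f) Ω ∧
    PolyFueter.IsFueterRegularOn (PolyFueter.tau Ω n f) Ω := by
  obtain ⟨n, rfl⟩ := Nat.exists_eq_add_of_le' hn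
  rw [PolyFueter.tau, Nat.add_sub_cancel]
  obtain ⟨h, hh, hfh⟩ := hf.exists_decomposition hΩ
  have hpow := PolyFueter.powV_eqOn hΩ.isOpen hh (n := n + 1) (f := f) fun q hq => by
    simpa [PolyFueter.reDerivSum] using hfh hq
  have hsmooth (m : ℕ) : ContDiffOn ℝ ∞ (PolyFueter.powV Ω m f) Ω :=
    (PolyFueter.contDiffOn_reDerivSum hh m).congr (hpow m)
  refine ⟨fun m _ => ⟨?_, (hsmooth _).continuousOn, ?_⟩, ?_, ?_, ?_⟩
  · exact ((hsmooth m).of_le (by exact_mod_cast le_top)).mono Set.sdiff_subset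
  · exact (((PolyFueter.rawV_eqOn_of_eqOn hΩ.isOpen (hpow m)).mono Set.sdiff_subset).trans
      ((PolyFueter.rawV_reDerivSum hΩ.isOpen hh m).trans
        ((hpow (m + 1)).symm.mono Set.sdiff_subset))).symm
  · exact (contDiffOn_infty.1 (hsmooth n)) 2
  all_goals
    have hreg := (PolyFueter.isRegularSlice_reDerivSum hΩ.isOpen
      hh (n := n)).isFueterRegularOn_laplacian hΩ.isOpen
    have hlap : ∀ q ∈ Ω, Laplacian.laplacian (PolyFueter.powV Ω n f) =ᶠ[𝓝 q]
        Laplacian.laplacian (PolyFueter.reDerivSum (n + 1) n h) := fun q hq =>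
      InnerProductSpace.laplacian_congr_nhds
        ((hpow n).eventuallyEq_of_mem (hΩ.isOpen.mem_nhds hq))
  · exact hreg.1.congr fun q hq => (hlap q hq).eq_of_nhds
  · exact fun q hq => (PolyFueter.cauchyFueter_congr (hlap q hq)).trans (hreg.2 q hq)
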